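/- Let $\mathbb Z^2_{even}=\{(x,t)\in\mathbb Z^2 : x+t \text{ is even}\}$. To each $z\in\mathbb Z^2_{even}$ attach a rate-one Poisson clock on the dynamical time axis $[0,\infty)$ and an arrow direction $\xi_z^\tau\in\{-1,+1\}$, $\tau\ge 0$: $\xi_z^0$ is uniform on $\{-1,+1\}$, each time the clock at $z$ rings the direction is redrawn uniformly from $\{-1,+1\}$, and $\tau\mapsto\xi_z^\tau$ is right continuous and constant between rings; all clocks, initial directions and redrawn directions are independent. For $\tau\ge 0$ let $S_0^\tau$ be the walk obtained by following the arrows from the origin, i.e. $S_0^\tau(0)=0$ and $S_0^\tau(n+1)=S_0^\tau(n)+\xi^\tau_{(S_0^\tau(n),\,n)}$ for $n\ge 0$. Call a path $\pi$ subdiffusive if there is $K\in(0,\infty)$ such that $\liminf_{n\to\infty}\pi(n)/\sqrt n\ge -K$ or $\limsup_{n\to\infty}\pi(n)/\sqrt n\le K$, and say that $\pi$ obeys the law of the iterated logarithm (LIL) if $\limsup_{n\to\infty}\pi(n)/\sqrt{2n\log\log n}=1$ and $\liminf_{n\to\infty}\pi(n)/\sqrt{2n\log\log n}=-1$. Then,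 almost surely, the set of times $\tau\in[0,\infty)$ at which $S_0^\tau$ is subdiffusive has Hausdorff dimension one. Hence, almost surely, the set of times $\tau\in[0,\infty)$ at which $S_0^\tau$ does not obey the LIL also has Hausdorff dimension one. -/

import Mathlib

open MeasureTheory ProbabilityTheory Filter

namespace DyDW

noncomputable section

/-- The even space-time lattice: points `(x, t)` of `ℤ × ℤ` with `x + t` even. -/
abbrev Site : Type := {z : ℤ × ℤ // Even (z.1 + z.2)}

/-- The space-time origin. -/
def origin : Site := ⟨(0, 0), by simp⟩

/-- The site `(x + s, t + 1)` at the end of the arrow of direction `s = ±1` rooted at `(x, t)`. -/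
def Site.next (z : Site) (s : ℤˣ) : Site :=
  ⟨(z.1.1 + (s : ℤ), z.1.2 + 1), by
    obtain ⟨⟨x, t⟩, h⟩ := z
    obtain ⟨k, hk⟩ := h
    rcases Int.units_eq_one_or s with rfl | rfl
    · exact ⟨k + 1, by simp at hk ⊢; omega⟩
    · exact ⟨k, by simp at hk ⊢; omega⟩⟩

/-- The site reached after `n` steps from `z` by following the arrows of the configuration `ξ`. -/
def follow (ξ : Site → ℤˣ) (z : Site) : ℕ → Site
  | 0 => z
  | n + 1 => (follow ξ z n).next (ξ (follow ξ z n))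

variable {Ω : Type*}

/-- The independent randomness that drives the arrows: at every site there is a rate one Poisson
clock, given by its i.i.d. exponential waiting times `T z 0, T z 1, …`, and a sequence of i.i.d.
symmetric signs: `ε z 0` is the initial direction of the arrow at `z`, and `ε z (n + 1)` is the
direction drawn at the ring that ends the waiting time `T z n`. All these variables are
independent. -/
structure IsDriving [MeasurableSpace Ω] (P : Measure Ω)
    (T : Site → ℕ → Ω → ℝ) (ε : Site → ℕ → Ω → ℤˣ) : Prop where
  hasLaw : ∀ z n, HasLaw (fun ω => (T z n ω, ε z n ω))
    ((expMeasure 1).prod (uniformOn (Set.univ : Set ℤˣ))) P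
  indep : iIndepFun (fun (p : Site × ℕ) ω => (T p.1 p.2 ω, ε p.1 p.2 ω)) P

/-- The dynamical time of the ring number `n` (counted from `0`) of the clock at `z`. -/
def ringTime (T : Site → ℕ → Ω → ℝ) (z : Site) (n : ℕ) (ω : Ω) : ℝ :=
  ∑ k ∈ Finset.range (n + 1), T z k ω

/-- The number of rings of the clock at `z` during `[0, τ]` (almost surely finite for all `τ`). -/
def ringCount (T : Site → ℕ → Ω → ℝ) (z : Site) (τ : ℝ) (ω : Ω) : ℕ :=
  {n : ℕ | ringTime T z n ω ≤ τ}.ncard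

/-- The (right continuous) dynamical arrow configuration: the direction at dynamical time `τ` of
the arrow at `z` is the one drawn at the last ring before or at `τ`. -/
def arrow (T : Site → ℕ → Ω → ℝ) (ε : Site → ℕ → Ω → ℤˣ) (τ : ℝ) (ω : Ω) (z : Site) : ℤˣ :=
  ε z (ringCount T z τ ω) ω

/-- The walk from the origin at dynamical time `τ`: its position at the walk time `n`. -/
def walk (T : Site → ℕ → Ω → ℝ) (ε : Site → ℕ → Ω → ℤˣ) (τ : ℝ) (ω : Ω) (n : ℕ) : ℤ :=
  (follow (arrow T ε τ ω) origin n).1.1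

/-- A path is subdiffusive if, for some `K ∈ (0, ∞)`, `liminf π(t) / √t ≥ -K` or
`limsup π(t) / √t ≤ K`; the lower and upper limits are taken in the extended reals. -/
def Subdiffusive (π : ℕ → ℤ) : Prop :=
  ∃ K : ℝ, 0 < K ∧
    (((-K : ℝ) : EReal) ≤ liminf (fun n : ℕ => (((π n : ℝ) / √(n : ℝ) : ℝ) : EReal)) atTop ∨
      limsup (fun n : ℕ => (((π n : ℝ) / √(n : ℝ) : ℝ) : EReal)) atTop ≤ ((K : ℝ) : EReal))

/-- The path `π` divided by the normalization `√(2 n log log n)` of the law of the iterated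
logarithm, as an extended real. -/
def lilRatio (π : ℕ → ℤ) (n : ℕ) : EReal :=
  (((π n : ℝ) / √(2 * (n : ℝ) * Real.log (Real.log (n : ℝ))) : ℝ) : EReal)

/-- A path obeys the law of the iterated logarithm. -/
def ObeysLIL (π : ℕ → ℤ) : Prop :=
  limsup (lilRatio π) atTop = 1 ∧ liminf (lilRatio π) atTop = -1

end

end DyDW

/-!
Arrow paths never cross. Let block `j` last `4 ^ (k + j + 1)` steps and start from a site
`blockStart j` whose height grows by `K * 2 ^ (k + j + 1)` from each block to the next. If, for
every `j`, the path started from `blockStart j` stays below the start of the next block, then the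
path from the origin is trapped below these paths, so it is at most of order `√n` and violates the
LIL. Distinct blocks use disjoint sets of arrows, hence are independent, and the product `f_J(τ)`
of normalized Lipschitz cutoffs of the first `J` block records has mean one.

At two dynamical times `s` and `t`, an arrow differs with a probability `q` of order `|s - t|`.
The two walkers move independently except where they meet. Compare the second one with a third
walker, which is independent of the first and deviates from the second only at meetings: the
distance of the first two increases on average by a multiple of `q` at each meeting, which bounds
the number of deviations, and Doob's `L²` inequality bounds their effect on the record. So the
correlation of the block `j` is at most `1 + C / √(2 ^ j * (q * 2 ^ (k + 1)))`; trivially it is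
also at most `(1 - 2 / K)⁻¹`. Multiplying over `j` gives
`E[f_J(s) f_J(t)] ≤ 1 + δ_k |s - t| ^ (-b)`, where `b` is small if `K` is large, and `δ_k → 0`.

If `α + b < 1`, the random measures `f_J(τ) dτ` therefore have, with probability close to one,
total mass at least `1 / 2` and bounded `α`-energy, and Frostman's argument bounds from below the
dimension of the limit set. That set is the intersection of the closures of the sets of good
times, which adds only countably many ring times to the intersection of the sets themselves.
-/

namespace DyDW

noncomputable section

/-- A Markov chain on `S` driven by finitely many innovations: from the state `σ` it moves to
`next σ a` with probability `weight σ a`. -/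
structure StepChain (S α : Type*) [Fintype α] where
  weight : S → α → ℝ
  next : S → α → S
  weight_nonneg : ∀ σ a, 0 ≤ weight σ a
  sum_weight : ∀ σ, ∑ a, weight σ a = 1

namespace StepChain

variable {S T α β : Type*} [Fintype α] [Fintype β] (M : StepChain S α) (N : StepChain T β)

/-- The transition operator of a chain acting on observables: `(M.avg ^ n) g σ` is the expectation
of `g` after `n` steps of the chain started at `σ`. -/
def avg : Module.End ℝ (S → ℝ) where
  toFun g σ := ∑ a, M.weight σ a * g (M.next σ a)
  map_add' g h := by funext σ; simp only [Pi.add_apply, mul_add, Finset.sum_add_distrib]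
  map_smul' c g := by
    funext σ
    simp only [Pi.smul_apply, smul_eq_mul, RingHom.id_apply, Finset.mul_sum, mul_left_comm]

lemma avg_apply (g : S → ℝ) (σ : S) : M.avg g σ = ∑ a, M.weight σ a * g (M.next σ a) := rfl

lemma avg_pow_succ (n : ℕ) (g : S → ℝ) : (M.avg ^ (n + 1)) g = (M.avg ^ n) (M.avg g) := by
  rw [pow_succ, Module.End.mul_apply]

lemma avg_pow_succ' (n : ℕ) (g : S → ℝ) : (M.avg ^ (n + 1)) g = M.avg ((M.avg ^ n) g) := by
  rw [pow_succ', Module.End.mul_apply]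

lemma avg_const (c : ℝ) : M.avg (fun _ => c) = fun _ => c := by
  funext σ
  rw [avg_apply, ← Finset.sum_mul, M.sum_weight, one_mul]

lemma avg_pow_const (c : ℝ) (n : ℕ) : (M.avg ^ n) (fun _ => c) = fun _ => c := by
  induction n with
  | zero => rfl
  | succ n ih => rw [avg_pow_succ, avg_const, ih]

/-- A set of states that the chain cannot leave. -/
def Invariant (s : Set S) : Prop := ∀ σ ∈ s, ∀ a, M.next σ a ∈ s

lemma invariant_univ : M.Invariant Set.univ := fun _ _ _ => Set.mem_univ _

section Invariant

variable {M} {s : Set S} {f g : S → ℝ} {σ : S}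

lemma Invariant.avg_mono (hs : M.Invariant s) (h : ∀ τ ∈ s, f τ ≤ g τ) (hσ : σ ∈ s) :
    M.avg f σ ≤ M.avg g σ :=
  Finset.sum_le_sum fun a _ => mul_le_mul_of_nonneg_left (h _ (hs σ hσ a)) (M.weight_nonneg σ a)

lemma Invariant.avg_pow_mono (hs : M.Invariant s) (h : ∀ τ ∈ s, f τ ≤ g τ) (n : ℕ) (hσ : σ ∈ s) :
    (M.avg ^ n) f σ ≤ (M.avg ^ n) g σ := by
  induction n generalizing σ with
  | zero => exact h σ hσ
  | succ n ih =>
    rw [avg_pow_succ', avg_pow_succ']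
    exact hs.avg_mono (fun τ hτ => ih hτ) hσ

lemma Invariant.avg_pow_le_add (hs : M.Invariant s) {c : ℝ} (h : ∀ τ ∈ s, M.avg f τ ≤ f τ + c)
    (n : ℕ) (hσ : σ ∈ s) : (M.avg ^ n) f σ ≤ f σ + n * c := by
  induction n with
  | zero => simp
  | succ n ih =>
    calc (M.avg ^ (n + 1)) f σ = (M.avg ^ n) (M.avg f) σ := by rw [avg_pow_succ]
      _ ≤ (M.avg ^ n) (f + fun _ => c) σ := hs.avg_pow_mono h n hσ
      _ = (M.avg ^ n) f σ + c := by rw [map_add, avg_pow_const]; rfl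
      _ ≤ f σ + (n + 1 : ℕ) * c := by push_cast; linarith

end Invariant

lemma avg_pow_nonneg {g : S → ℝ} (hg : ∀ σ, 0 ≤ g σ) (n : ℕ) (σ : S) : 0 ≤ (M.avg ^ n) g σ := by
  simpa only [avg_pow_const] using
    M.invariant_univ.avg_pow_mono (f := fun _ => 0) (fun τ _ => hg τ) n (Set.mem_univ σ)

lemma sq_avg_pow_le (f : S → ℝ) (n : ℕ) (σ : S) :
    ((M.avg ^ n) f σ) ^ 2 ≤ (M.avg ^ n) (f ^ 2) σ := by
  set m := (M.avg ^ n) f σ with hm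
  have variance_nonneg : 0 ≤ (M.avg ^ n) ((f - fun _ => m) ^ 2) σ :=
    M.avg_pow_nonneg (fun τ => sq_nonneg (f τ - m)) n σ
  have expand : (f - fun _ => m) ^ 2 = f ^ 2 - (2 * m) • f + fun _ => m ^ 2 := by
    funext τ
    simp only [Pi.pow_apply, Pi.sub_apply, Pi.add_apply, Pi.smul_apply, smul_eq_mul]
    ring
  rw [expand, map_add, map_sub, map_smul, avg_pow_const] at variance_nonneg
  simp only [Pi.add_apply, Pi.sub_apply, Pi.smul_apply, smul_eq_mul, ← hm] at variance_nonneg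
  linarith

lemma avg_pow_le_sqrt {f : S → ℝ} {n : ℕ} {σ : S} {v : ℝ} (h : (M.avg ^ n) (f ^ 2) σ ≤ v) :
    (M.avg ^ n) f σ ≤ √v :=
  Real.le_sqrt_of_sq_le ((M.sq_avg_pow_le f n σ).trans h)

variable {M N} in
lemma avg_pow_comp {p : S → T} (h : ∀ g, M.avg (g ∘ p) = N.avg g ∘ p) (n : ℕ) (g : T → ℝ) :
    (M.avg ^ n) (g ∘ p) = (N.avg ^ n) g ∘ p := by
  induction n generalizing g with
  | zero => rfl
  | succ n ih => rw [avg_pow_succ, avg_pow_succ, h, ih]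

/-- Two independent chains run in parallel. -/
def prod : StepChain (S × T) (α × β) where
  weight σ a := M.weight σ.1 a.1 * N.weight σ.2 a.2
  next σ a := (M.next σ.1 a.1, N.next σ.2 a.2)
  weight_nonneg σ a := mul_nonneg (M.weight_nonneg _ _) (N.weight_nonneg _ _)
  sum_weight σ := by
    rw [Fintype.sum_prod_type, ← Fintype.sum_mul_sum, M.sum_weight, N.sum_weight, one_mul]

lemma prod_avg_mul (g : S → ℝ) (h : T → ℝ) :
    (M.prod N).avg (fun σ => g σ.1 * h σ.2) = fun σ => M.avg g σ.1 * N.avg h σ.2 := by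
  funext σ
  simp only [avg_apply, prod, Fintype.sum_prod_type, Fintype.sum_mul_sum, mul_mul_mul_comm]

lemma prod_avg_pow_mul (g : S → ℝ) (h : T → ℝ) (n : ℕ) :
    ((M.prod N).avg ^ n) (fun σ => g σ.1 * h σ.2) =
      fun σ => (M.avg ^ n) g σ.1 * (N.avg ^ n) h σ.2 := by
  induction n generalizing g h with
  | zero => rfl
  | succ n ih => rw [avg_pow_succ, prod_avg_mul, ih, ← avg_pow_succ, ← avg_pow_succ]

end StepChain

/-- One step of a walker, recorded as the pair of its position and its running maximum. -/
def walkerStep (w : ℤ × ℤ) (s : ℤˣ) : ℤ × ℤ := (w.1 + s, max w.2 (w.1 + s))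

/-- The law of two symmetric signs that differ with probability `q`. -/
def coinWeight (q : unitInterval) (a b : ℤˣ) : ℝ := if a = b then (1 - q) / 2 else q / 2

/-- The simple random walk with its running maximum. -/
def soloChain : StepChain (ℤ × ℤ) ℤˣ where
  weight _ _ := 1 / 2
  next := walkerStep
  weight_nonneg _ _ := by positivity
  sum_weight _ := by simp

lemma sum_units (g : ℤˣ → ℝ) : ∑ a : ℤˣ, g a = g 1 + g (-1) := by
  rw [UnitsInt.univ, Finset.sum_pair (by decide)]

section Coin

variable (q : unitInterval)

lemma coinWeight_nonneg (a b : ℤˣ) : 0 ≤ coinWeight q a b := by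
  have := q.2.1
  have := q.2.2
  unfold coinWeight
  split_ifs <;> linarith

lemma sum_mul_coinWeight (g : ℤˣ → ℤˣ → ℝ) :
    ∑ a : ℤˣ, ∑ b : ℤˣ, coinWeight q a b * g a b =
      (1 - q) / 2 * (g 1 1 + g (-1) (-1)) + q / 2 * (g 1 (-1) + g (-1) 1) := by
  have h₁ : (1 : ℤˣ) ≠ -1 := by decide
  simp only [sum_units, coinWeight, h₁, h₁.symm, if_true, if_false]
  ring

lemma sum_coinWeight_right (a : ℤˣ) : ∑ b, coinWeight q a b = 1 / 2 := by
  have h₁ : (1 : ℤˣ) ≠ -1 := by decide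
  rcases Int.units_eq_one_or a with rfl | rfl <;>
    simp only [sum_units, coinWeight, h₁, h₁.symm, if_true, if_false] <;> ring

lemma sum_coinWeight_left (b : ℤˣ) : ∑ a, coinWeight q a b = 1 / 2 := by
  have h₁ : (1 : ℤˣ) ≠ -1 := by decide
  rcases Int.units_eq_one_or b with rfl | rfl <;>
    simp only [sum_units, coinWeight, h₁, h₁.symm, if_true, if_false] <;> ring

/-- Two walkers that follow the arrows at two dynamical times between which an arrow changes with
probability `q`: their steps are independent unless they are at the same place. -/
def pairChain : StepChain ((ℤ × ℤ) × (ℤ × ℤ)) (ℤˣ × ℤˣ) where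
  weight σ e := if σ.1.1 = σ.2.1 then coinWeight q e.1 e.2 else 1 / 4
  next σ e := (walkerStep σ.1 e.1, walkerStep σ.2 e.2)
  weight_nonneg σ e := by
    split_ifs
    exacts [coinWeight_nonneg q _ _, by positivity]
  sum_weight σ := by
    split_ifs
    · have := sum_mul_coinWeight q fun _ _ => 1
      simp only [mul_one] at this
      rw [Fintype.sum_prod_type, this]
      ring
    · simp

lemma pairChain_avg_of_eq {σ : (ℤ × ℤ) × (ℤ × ℤ)} (h : σ.1.1 = σ.2.1)
    (g : (ℤ × ℤ) × (ℤ × ℤ) → ℝ) :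
    (pairChain q).avg g σ =
      ∑ a : ℤˣ, ∑ b : ℤˣ, coinWeight q a b * g (walkerStep σ.1 a, walkerStep σ.2 b) := by
  rw [StepChain.avg_apply, Fintype.sum_prod_type]
  simp only [pairChain, if_pos h]

lemma pairChain_avg_of_ne {σ : (ℤ × ℤ) × (ℤ × ℤ)} (h : σ.1.1 ≠ σ.2.1)
    (g : (ℤ × ℤ) × (ℤ × ℤ) → ℝ) :
    (pairChain q).avg g σ =
      ∑ a : ℤˣ, ∑ b : ℤˣ, 1 / 4 * g (walkerStep σ.1 a, walkerStep σ.2 b) := by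
  rw [StepChain.avg_apply, Fintype.sum_prod_type]
  simp only [pairChain, if_neg h]

end Coin

lemma soloChain_avg_apply (g : ℤ × ℤ → ℝ) (w : ℤ × ℤ) :
    soloChain.avg g w = (g (walkerStep w 1) + g (walkerStep w (-1))) / 2 := by
  rw [StepChain.avg_apply, sum_units]
  simp only [soloChain]
  ring

lemma pairChain_avg_comp_fst (q : unitInterval) (g : ℤ × ℤ → ℝ) :
    (pairChain q).avg (g ∘ Prod.fst) = soloChain.avg g ∘ Prod.fst := by
  funext σ
  change _ = soloChain.avg g σ.1
  rw [soloChain_avg_apply]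
  by_cases h : σ.1.1 = σ.2.1
  · rw [pairChain_avg_of_eq q h, sum_mul_coinWeight]
    simp only [Function.comp_apply]
    ring
  · rw [pairChain_avg_of_ne q h]
    simp only [sum_units, Function.comp_apply]
    ring

/-- State of the coupling of the two walkers of `pairChain`, here `fst` and `snd`, with a walker
`trd` that is independent of `fst`. The field `gap` is the running maximum of the position of
`trd` relative to `snd`. -/
structure Coupled where
  fst : ℤ × ℤ
  snd : ℤ × ℤ
  trd : ℤ × ℤ
  gap : ℤ

namespace Coupled

/-- The sign followed by `snd`: its own coin `b` when it meets `fst`, and the coin `c` of `trd`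
otherwise. -/
def sndSign (σ : Coupled) (b c : ℤˣ) : ℤˣ := if σ.fst.1 = σ.snd.1 then b else c

/-- One step of the coupling. -/
def step (σ : Coupled) (a b c : ℤˣ) : Coupled where
  fst := walkerStep σ.fst a
  snd := walkerStep σ.snd (σ.sndSign b c)
  trd := walkerStep σ.trd c
  gap := max σ.gap ((σ.trd.1 + c) - (σ.snd.1 + σ.sndSign b c))

/-- The coupling with all three walkers at `a`. -/
def start (a : ℤ) : Coupled := ⟨(a, a), (a, a), (a, a), 0⟩

/-- The invariants of the coupling: `fst` and `snd` have the same parity, and the maxima of `snd`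
and `trd` differ by at most `gap`. -/
def Admissible (σ : Coupled) : Prop :=
  Even (σ.fst.1 - σ.snd.1) ∧ 0 ≤ σ.gap ∧ σ.trd.2 ≤ σ.snd.2 + σ.gap

lemma admissible_start (a : ℤ) : (start a).Admissible := by
  simp [Admissible, start]

end Coupled

lemma even_add_unit_sub_add_unit {x y : ℤ} (h : Even (x - y)) (a b : ℤˣ) :
    Even (x + a - (y + b)) := by
  have odd_unit (s : ℤˣ) : Odd (s : ℤ) := by
    rcases Int.units_eq_one_or s with rfl | rfl <;> decide
  rw [add_sub_add_comm]
  exact h.add ((odd_unit a).sub_odd (odd_unit b))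

/-- The coupling as a chain, with innovations `(a, b, c)`: the coins `a` and `b` differ with
probability `q`, and `c` is independent of them. -/
def coupledChain (q : unitInterval) : StepChain Coupled (ℤˣ × ℤˣ × ℤˣ) where
  weight _ e := coinWeight q e.1 e.2.1 / 2
  next σ e := σ.step e.1 e.2.1 e.2.2
  weight_nonneg _ e := div_nonneg (coinWeight_nonneg q _ _) zero_le_two
  sum_weight _ := by
    simp only [Fintype.sum_prod_type, sum_units, coinWeight]
    norm_num
    ring

lemma coupledChain_avg_apply (q : unitInterval) (g : Coupled → ℝ) (σ : Coupled) :
    (coupledChain q).avg g σ = ∑ a : ℤˣ, ∑ b : ℤˣ,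
      coinWeight q a b * ((g (σ.step a b 1) + g (σ.step a b (-1))) / 2) := by
  simp only [StepChain.avg_apply, Fintype.sum_prod_type, coupledChain, sum_units]
  ring

lemma invariant_admissible (q : unitInterval) :
    (coupledChain q).Invariant {σ | σ.Admissible} := by
  rintro σ ⟨heven, hgap, hmax⟩ ⟨a, b, c⟩
  refine ⟨even_add_unit_sub_add_unit heven _ _, le_max_of_le_left hgap, ?_⟩
  simp only [coupledChain, Coupled.step, walkerStep]
  omega

lemma coupledChain_avg_comp_pair (q : unitInterval) (g : (ℤ × ℤ) × (ℤ × ℤ) → ℝ) :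
    (coupledChain q).avg (g ∘ fun σ => (σ.fst, σ.snd)) =
      (pairChain q).avg g ∘ fun σ => (σ.fst, σ.snd) := by
  funext σ
  change _ = (pairChain q).avg g (σ.fst, σ.snd)
  rw [coupledChain_avg_apply, sum_mul_coinWeight]
  by_cases h : σ.fst.1 = σ.snd.1
  · rw [pairChain_avg_of_eq q h, sum_mul_coinWeight]
    simp only [Function.comp_apply, Coupled.step, Coupled.sndSign, if_pos h]
    ring
  · rw [pairChain_avg_of_ne q h]
    simp only [sum_units, Function.comp_apply, Coupled.step, Coupled.sndSign, if_neg h]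
    ring

lemma coupledChain_avg_comp_prod (q : unitInterval) (g : (ℤ × ℤ) × (ℤ × ℤ) → ℝ) :
    (coupledChain q).avg (g ∘ fun σ => (σ.fst, σ.trd)) =
      (soloChain.prod soloChain).avg g ∘ fun σ => (σ.fst, σ.trd) := by
  funext σ
  change _ = (soloChain.prod soloChain).avg g (σ.fst, σ.trd)
  rw [coupledChain_avg_apply, sum_mul_coinWeight, StepChain.avg_apply]
  simp only [Fintype.sum_prod_type, sum_units, Function.comp_apply, Coupled.step, StepChain.prod,
    soloChain]
  ring

/-- A quadratic form in the running maximum `d` and the current value `s` of a walk. It dominates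
`d ^ 2` and does not increase when `d` is updated, while the steps of the walk only affect the
square `4 * s ^ 2` on average: this is Doob's `L²` inequality in one-step form. -/
def doobPotential (d s : ℝ) : ℝ := 2 * d ^ 2 - 4 * d * s + 4 * s ^ 2

lemma sq_le_doobPotential (d s : ℝ) : d ^ 2 ≤ doobPotential d s := by
  unfold doobPotential
  nlinarith [sq_nonneg (d - 2 * s)]

lemma doobPotential_max_le (d s : ℝ) : doobPotential (max d s) s ≤ doobPotential d s := by
  unfold doobPotential
  rcases le_total d s with h | h
  · rw [max_eq_right h]
    nlinarith [sq_nonneg (d - s)]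
  · rw [max_eq_left h]

lemma soloChain_avg_doobPotential_le (a : ℤ) (w : ℤ × ℤ) :
    soloChain.avg (fun w => doobPotential (w.2 - a) (w.1 - a)) w ≤
      doobPotential (w.2 - a) (w.1 - a) + 4 := by
  have hstep (s : ℤˣ) : doobPotential ((walkerStep w s).2 - a) ((walkerStep w s).1 - a) ≤
      doobPotential (w.2 - a) (w.1 + (s : ℤ) - a) := by
    simp only [walkerStep]
    push_cast
    rw [← max_sub_sub_right]
    exact doobPotential_max_le _ _
  rw [soloChain_avg_apply]
  have h₁ := hstep 1
  have h₂ := hstep (-1)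
  simp only [doobPotential, Units.val_one, Units.val_neg] at h₁ h₂ ⊢
  push_cast at h₁ h₂
  linarith

lemma soloChain_avg_pow_max_le (a : ℤ) (n : ℕ) :
    (soloChain.avg ^ n) (fun w => (w.2 : ℝ) - a) (a, a) ≤ 2 * √n := by
  have hsq : (soloChain.avg ^ n) ((fun w => (w.2 : ℝ) - a) ^ 2) (a, a) ≤ 4 * n := by
    calc _ ≤ (soloChain.avg ^ n) (fun w => doobPotential (w.2 - a) (w.1 - a)) (a, a) :=
          soloChain.invariant_univ.avg_pow_mono (fun w _ => sq_le_doobPotential _ _) n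
            (Set.mem_univ _)
      _ ≤ doobPotential (a - a) (a - a) + n * 4 :=
          soloChain.invariant_univ.avg_pow_le_add
            (fun w _ => soloChain_avg_doobPotential_le a w) n (Set.mem_univ _)
      _ = 4 * n := by simp [doobPotential, mul_comm]
  calc _ ≤ √(4 * n) := soloChain.avg_pow_le_sqrt hsq
    _ = 2 * √n := by rw [show (4 : ℝ) = 2 ^ 2 by norm_num, Real.sqrt_mul (sq_nonneg _),
        Real.sqrt_sq zero_le_two]

section Gap

variable (q : unitInterval)

lemma pairChain_avg_sq_sub_le (σ : (ℤ × ℤ) × (ℤ × ℤ)) :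
    (pairChain q).avg (fun τ => ((τ.1.1 : ℝ) - τ.2.1) ^ 2) σ ≤ ((σ.1.1 : ℝ) - σ.2.1) ^ 2 + 4 := by
  by_cases h : σ.1.1 = σ.2.1
  · rw [pairChain_avg_of_eq q h, sum_mul_coinWeight]
    simp only [walkerStep, h, Units.val_one, Units.val_neg]
    push_cast
    linarith [q.2.2]
  · rw [pairChain_avg_of_ne q h]
    simp only [walkerStep, sum_units, Units.val_one, Units.val_neg]
    push_cast
    linarith

lemma abs_add_two_add_abs_sub_two {m : ℤ} (hm : Even m) (h0 : m ≠ 0) :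
    |m + 2| + |m - 2| = 2 * |m| := by
  obtain ⟨k, rfl⟩ := hm
  rcases abs_cases (k + k) with h | h <;> rcases abs_cases (k + k + 2) with h' | h' <;>
    rcases abs_cases (k + k - 2) with h'' | h'' <;> omega

/-- Parity prevents the two walkers from crossing without meeting, so their distance has a
positive drift exactly when they meet. -/
lemma pairChain_avg_abs_sub {σ : (ℤ × ℤ) × (ℤ × ℤ)} (hσ : Even (σ.1.1 - σ.2.1)) :
    (pairChain q).avg (fun τ => |(τ.1.1 : ℝ) - τ.2.1|) σ =
      |(σ.1.1 : ℝ) - σ.2.1| + if σ.1.1 = σ.2.1 then 2 * (q : ℝ) else 0 := by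
  by_cases h : σ.1.1 = σ.2.1
  · rw [pairChain_avg_of_eq q h, sum_mul_coinWeight, if_pos h]
    simp only [walkerStep, h, Units.val_one, Units.val_neg]
    push_cast
    ring_nf
    norm_num
    ring
  · have habs := abs_add_two_add_abs_sub_two hσ (sub_ne_zero.2 h)
    have habs' : |(σ.1.1 : ℝ) - σ.2.1 + 2| + |(σ.1.1 : ℝ) - σ.2.1 - 2| =
        2 * |(σ.1.1 : ℝ) - σ.2.1| := by exact_mod_cast habs
    rw [pairChain_avg_of_ne q h, if_neg h, add_zero]
    simp only [walkerStep, sum_units, Units.val_one, Units.val_neg]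
    push_cast
    ring_nf at habs' ⊢
    linarith

lemma pairChain_avg_pow_abs_sub_le (a : ℤ) (n : ℕ) :
    ((pairChain q).avg ^ n) (fun τ => |(τ.1.1 : ℝ) - τ.2.1|) ((a, a), (a, a)) ≤ 2 * √n := by
  have hsq : ((pairChain q).avg ^ n) ((fun τ => |(τ.1.1 : ℝ) - τ.2.1|) ^ 2) ((a, a), (a, a)) ≤
      4 * n := by
    have := (pairChain q).invariant_univ.avg_pow_le_add
      (fun σ _ => pairChain_avg_sq_sub_le q σ) n (Set.mem_univ ((a, a), (a, a)))
    simp only [sub_self] at this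
    have hfun : (fun τ : (ℤ × ℤ) × (ℤ × ℤ) => |(τ.1.1 : ℝ) - τ.2.1|) ^ 2 =
        fun τ => ((τ.1.1 : ℝ) - τ.2.1) ^ 2 := funext fun τ => sq_abs _
    rw [hfun]
    linarith
  calc _ ≤ √(4 * n) := (pairChain q).avg_pow_le_sqrt hsq
    _ = 2 * √n := by rw [show (4 : ℝ) = 2 ^ 2 by norm_num, Real.sqrt_mul (sq_nonneg _),
        Real.sqrt_sq zero_le_two]

/-- While `fst` and `snd` are apart, `trd` moves with `snd`. -/
lemma coupledChain_avg_doobPotential_le (σ : Coupled) :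
    (coupledChain q).avg (fun τ => doobPotential τ.gap (τ.trd.1 - τ.snd.1)) σ ≤
      doobPotential σ.gap (σ.trd.1 - σ.snd.1) + if σ.fst.1 = σ.snd.1 then 8 else 0 := by
  set s : ℝ := σ.trd.1 - σ.snd.1 with hs
  have hstep (a b c : ℤˣ) :
      doobPotential (σ.step a b c).gap ((σ.step a b c).trd.1 - (σ.step a b c).snd.1) ≤
        doobPotential σ.gap (s + ((c : ℤ) - (σ.sndSign b c : ℤ))) := by
    have := doobPotential_max_le σ.gap (s + ((c : ℤ) - (σ.sndSign b c : ℤ)))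
    convert this using 2 <;> simp only [Coupled.step, walkerStep, hs] <;> push_cast <;> ring_nf
  calc _ ≤ ∑ a : ℤˣ, ∑ b : ℤˣ, coinWeight q a b *
        ((doobPotential σ.gap (s + (1 - (σ.sndSign b 1 : ℤ)))
          + doobPotential σ.gap (s + (-1 - (σ.sndSign b (-1) : ℤ)))) / 2) := by
        rw [coupledChain_avg_apply]
        gcongr with a _ b _
        · exact coinWeight_nonneg q a b
        · simpa using hstep a b 1
        · simpa using hstep a b (-1)
    _ ≤ _ := by
        rw [sum_mul_coinWeight]
        simp only [Coupled.sndSign, doobPotential]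
        split_ifs <;> simp only [Units.val_one, Units.val_neg] <;> push_cast <;> linarith

variable {q}

/-- The drift of the distance of `fst` and `snd` at their meetings pays for the drift of the
potential of the gap, which vanishes elsewhere. -/
lemma coupledChain_avg_doobPotential_sub_abs_le (hq : 0 < (q : ℝ)) {σ : Coupled}
    (hσ : σ.Admissible) :
    (coupledChain q).avg ((fun τ => doobPotential τ.gap (τ.trd.1 - τ.snd.1))
      - (4 / (q : ℝ)) • fun τ => |(τ.fst.1 : ℝ) - τ.snd.1|) σ ≤
      doobPotential σ.gap (σ.trd.1 - σ.snd.1) - 4 / q * |(σ.fst.1 : ℝ) - σ.snd.1| := by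
  have hdoob := coupledChain_avg_doobPotential_le q σ
  have habs : (coupledChain q).avg (fun τ => |(τ.fst.1 : ℝ) - τ.snd.1|) σ =
      |(σ.fst.1 : ℝ) - σ.snd.1| + if σ.fst.1 = σ.snd.1 then 2 * (q : ℝ) else 0 :=
    (congrFun (coupledChain_avg_comp_pair q fun τ => |(τ.1.1 : ℝ) - τ.2.1|) σ).trans
      (pairChain_avg_abs_sub q hσ.1)
  have hcancel : (if σ.fst.1 = σ.snd.1 then (8 : ℝ) else 0) =
      4 / q * if σ.fst.1 = σ.snd.1 then 2 * (q : ℝ) else 0 := by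
    split_ifs
    · field_simp
      norm_num
    · rw [mul_zero]
  rw [map_sub, map_smul, Pi.sub_apply, Pi.smul_apply, smul_eq_mul, habs, mul_add]
  linarith

lemma coupledChain_avg_pow_gap_le (hq : 0 < (q : ℝ)) (a : ℤ) (n : ℕ) :
    ((coupledChain q).avg ^ n) (fun σ => (σ.gap : ℝ)) (Coupled.start a) ≤ √(8 * √n / q) := by
  set D : Coupled → ℝ := fun τ => doobPotential τ.gap (τ.trd.1 - τ.snd.1) with hD
  set X : Coupled → ℝ := fun τ => |(τ.fst.1 : ℝ) - τ.snd.1| with hX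
  have hstart := Coupled.admissible_start a
  have hsuper : ((coupledChain q).avg ^ n) (D - (4 / (q : ℝ)) • X) (Coupled.start a) ≤ 0 := by
    have := (invariant_admissible q).avg_pow_le_add (f := D - (4 / (q : ℝ)) • X) (c := 0)
      (fun σ hσ => (coupledChain_avg_doobPotential_sub_abs_le hq hσ).trans_eq (add_zero _).symm)
      n hstart
    simpa [hD, hX, Coupled.start, doobPotential] using this
  have hX_le : ((coupledChain q).avg ^ n) X (Coupled.start a) ≤ 2 * √n :=
    (congrFun (StepChain.avg_pow_comp (coupledChain_avg_comp_pair q) n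
      fun τ => |(τ.1.1 : ℝ) - τ.2.1|) (Coupled.start a)).trans_le
      (pairChain_avg_pow_abs_sub_le q a n)
  rw [map_sub, map_smul, Pi.sub_apply, Pi.smul_apply, smul_eq_mul, sub_nonpos] at hsuper
  refine (coupledChain q).avg_pow_le_sqrt ?_
  calc _ ≤ ((coupledChain q).avg ^ n) D (Coupled.start a) :=
        (coupledChain q).invariant_univ.avg_pow_mono (fun σ _ => sq_le_doobPotential _ _) n
          (Set.mem_univ _)
    _ ≤ 4 / q * (2 * √n) := hsuper.trans (by gcongr)
    _ = 8 * √n / q := by ring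

end Gap

/-- A continuous cutoff of the event that the running maximum of a walker stays below `a + R`,
equal to `1` when the maximum is at most `a`. -/
def bump (a R : ℝ) (w : ℤ × ℤ) : ℝ := min 1 (max 0 (1 - (w.2 - a) / R))

section Bump

variable {a R : ℝ}

lemma bump_nonneg (a R : ℝ) (w : ℤ × ℤ) : 0 ≤ bump a R w := le_min zero_le_one (le_max_left _ _)

lemma bump_le_one (a R : ℝ) (w : ℤ × ℤ) : bump a R w ≤ 1 := min_le_left _ _

lemma one_sub_div_le_bump (hR : 0 < R) {w : ℤ × ℤ} (hw : a ≤ w.2) :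
    1 - (w.2 - a) / R ≤ bump a R w :=
  le_min (sub_le_self 1 (div_nonneg (sub_nonneg.2 hw) hR.le)) (le_max_right _ _)

lemma lt_of_bump_pos (hR : 0 < R) {w : ℤ × ℤ} (h : 0 < bump a R w) : (w.2 : ℝ) < a + R := by
  rw [bump, lt_min_iff, lt_max_iff] at h
  simp only [lt_irrefl, false_or, sub_pos, div_lt_one hR] at h
  linarith [h.2]

lemma bump_le_bump_add (hR : 0 < R) {v w : ℤ × ℤ} {d : ℤ} (hd : 0 ≤ d) (h : v.2 ≤ w.2 + d) :
    bump a R w ≤ bump a R v + d / R := by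
  have hd' : (0 : ℝ) ≤ d / R := div_nonneg (by exact_mod_cast hd) hR.le
  have hslope : 1 - ((w.2 : ℝ) - a) / R ≤ 1 - (v.2 - a) / R + d / R := by
    have h' : (v.2 : ℝ) ≤ w.2 + d := by exact_mod_cast h
    have : ((v.2 : ℝ) - a) / R ≤ (w.2 - a) / R + d / R := by
      rw [← add_div]
      gcongr
      linarith
    linarith
  unfold bump
  rw [← min_add_add_right, ← max_add_add_right]
  exact min_le_min (le_add_of_nonneg_right hd')
    (max_le_max (by rwa [zero_add]) hslope)

lemma le_soloChain_avg_pow_bump (hR : 0 < R) (a : ℤ) (n : ℕ) :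
    1 - 2 * √n / R ≤ (soloChain.avg ^ n) (bump a R) (a, a) := by
  have hinv : soloChain.Invariant {w | a ≤ w.2} := fun w (hw : a ≤ w.2) s => le_max_of_le_left hw
  have hlin : (fun w : ℤ × ℤ => 1 - ((w.2 : ℝ) - a) / R) =
      (fun _ => 1) - R⁻¹ • fun w => (w.2 : ℝ) - a := by
    funext w
    simp only [Pi.sub_apply, Pi.smul_apply, smul_eq_mul, div_eq_inv_mul]
  calc 1 - 2 * √n / R
      ≤ 1 - R⁻¹ * (soloChain.avg ^ n) (fun w => (w.2 : ℝ) - a) (a, a) := by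
        rw [div_eq_inv_mul]
        gcongr
        exact soloChain_avg_pow_max_le a n
    _ = (soloChain.avg ^ n) (fun w => 1 - ((w.2 : ℝ) - a) / R) (a, a) := by
        rw [hlin, map_sub, map_smul, soloChain.avg_pow_const]
        rfl
    _ ≤ (soloChain.avg ^ n) (bump a R) (a, a) :=
        hinv.avg_pow_mono (fun w hw => one_sub_div_le_bump hR (by exact_mod_cast hw)) n
          (le_refl a)

lemma pairChain_avg_pow_bump_mul_bump_le {q : unitInterval} (hq : 0 < (q : ℝ)) (hR : 0 < R)
    (a : ℤ) (n : ℕ) :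
    ((pairChain q).avg ^ n) (fun σ => bump a R σ.1 * bump a R σ.2) ((a, a), (a, a)) ≤
      ((soloChain.avg ^ n) (bump a R) (a, a)) ^ 2 + √(8 * √n / q) / R := by
  have hpair := congrFun (StepChain.avg_pow_comp (coupledChain_avg_comp_pair q) n
    fun σ => bump a R σ.1 * bump a R σ.2) (Coupled.start a)
  have hprod := congrFun ((StepChain.avg_pow_comp (coupledChain_avg_comp_prod q) n
    fun σ => bump a R σ.1 * bump a R σ.2).trans
      (by rw [soloChain.prod_avg_pow_mul])) (Coupled.start a)
  have hle (σ : Coupled) (hσ : σ.Admissible) :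
      bump a R σ.fst * bump a R σ.snd ≤ bump a R σ.fst * bump a R σ.trd + R⁻¹ * σ.gap := by
    obtain ⟨-, hgap, hmax⟩ := hσ
    have hgap' : (0 : ℝ) ≤ σ.gap / R := div_nonneg (by exact_mod_cast hgap) hR.le
    calc bump a R σ.fst * bump a R σ.snd
        ≤ bump a R σ.fst * (bump a R σ.trd + σ.gap / R) :=
          mul_le_mul_of_nonneg_left (bump_le_bump_add hR hgap hmax) (bump_nonneg _ _ _)
      _ ≤ bump a R σ.fst * bump a R σ.trd + R⁻¹ * σ.gap := by
          rw [mul_add, ← div_eq_inv_mul]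
          gcongr
          exact mul_le_of_le_one_left hgap' (bump_le_one _ _ _)
  calc _ = ((coupledChain q).avg ^ n) (fun σ => bump a R σ.fst * bump a R σ.snd)
        (Coupled.start a) := hpair.symm
    _ ≤ ((coupledChain q).avg ^ n) ((fun σ => bump a R σ.fst * bump a R σ.trd)
          + R⁻¹ • fun σ => (σ.gap : ℝ)) (Coupled.start a) :=
        (invariant_admissible q).avg_pow_mono hle n (Coupled.admissible_start a)
    _ = ((soloChain.avg ^ n) (bump a R) (a, a)) ^ 2
          + R⁻¹ * ((coupledChain q).avg ^ n) (fun σ => (σ.gap : ℝ)) (Coupled.start a) := by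
        rw [map_add, map_smul, Pi.add_apply, Pi.smul_apply, smul_eq_mul, sq]
        exact congrArg (· + _) hprod
    _ ≤ _ := by
        rw [← div_eq_inv_mul]
        gcongr
        exact coupledChain_avg_pow_gap_le hq a n

end Bump

section SlowProduct

variable {b : ℝ}

/-- At small `v` the loss of the factor `ρ` is paid by the decrease of `v ^ (-b)` by the factor
`2 ^ (-b)`, of which `2 ^ (-(b / 2))` is left. -/
lemma one_add_rpow_mul_le_of_le {A v v₁ ρ : ℝ} (hb : 0 < b) (hb' : b ≤ 2) (hv : 0 < v)
    (hv₁ : v ≤ v₁) (hA : v₁ ^ b / (1 - 2 ^ (-(b / 2))) ≤ A) (hρ : ρ ≤ 2 ^ (b / 2)) :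
    (1 + A * (2 * v) ^ (-b)) * ρ ≤ 1 + A * v ^ (-b) := by
  set w := v ^ (-b) with hw
  set θ : ℝ := 2 ^ (-(b / 2)) with hθ
  have : 0 < w := Real.rpow_pos_of_pos hv _
  have hv₁0 : 0 < v₁ := hv.trans_le hv₁
  have hθ1 : 0 < 1 - θ :=
    sub_pos.2 (Real.rpow_lt_one_of_one_lt_of_neg one_lt_two (by linarith))
  have hA0 : 0 ≤ A := (by positivity : (0 : ℝ) ≤ v₁ ^ b / (1 - θ)).trans hA
  have hβ : (2 : ℝ) ^ (b / 2) ≤ 2 := by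
    simpa using Real.rpow_le_rpow_of_exponent_le one_le_two (show b / 2 ≤ 1 by linarith)
  have hβθ : (2 : ℝ) ^ (-b) * 2 ^ (b / 2) = θ := by
    rw [hθ, ← Real.rpow_add two_pos]
    ring_nf
  have hone : 1 ≤ A * (1 - θ) * w :=
    calc 1 = v ^ b * w := by rw [hw, ← Real.rpow_add hv, add_neg_cancel, Real.rpow_zero]
      _ ≤ v₁ ^ b * w := by gcongr
      _ ≤ A * (1 - θ) * w := by gcongr; exact (div_le_iff₀ hθ1).1 hA
  calc (1 + A * (2 * v) ^ (-b)) * ρ ≤ (1 + A * (2 ^ (-b) * w)) * 2 ^ (b / 2) := by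
        rw [Real.mul_rpow two_pos.le hv.le]
        gcongr
    _ = 2 ^ (b / 2) + A * w * (2 ^ (-b) * 2 ^ (b / 2)) := by ring
    _ ≤ 2 + A * w * θ := by rw [hβθ]; gcongr
    _ ≤ 1 + A * w := by linarith

lemma one_add_rpow_mul_le_of_ge {A C v ρ : ℝ} (hb : 0 < b) (hb' : b ≤ 1 / 2) (hC : 0 ≤ C)
    (hv : 1 ≤ v) (hv' : (2 * C / (1 - 2 ^ (-b))) ^ 2 ≤ v) (hA : 2 * C / (1 - 2 ^ (-b)) ≤ A)
    (hρ : ρ ≤ 1 + C / √v) :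
    (1 + A * (2 * v) ^ (-b)) * ρ ≤ 1 + A * v ^ (-b) := by
  set w := v ^ (-b) with hw
  set θ : ℝ := 2 ^ (-b)
  have hv0 : 0 < v := zero_lt_one.trans_le hv
  have : 0 < w := Real.rpow_pos_of_pos hv0 _
  have : 0 < θ := by positivity
  have hθ1 : 0 < 1 - θ :=
    sub_pos.2 (Real.rpow_lt_one_of_one_lt_of_neg one_lt_two (by linarith))
  have hA0 : 0 ≤ A := (by positivity : 0 ≤ 2 * C / (1 - θ)).trans hA
  have hCA : C ≤ A * (1 - θ) / 2 := by linarith [(div_le_iff₀ hθ1).1 hA]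
  have hCw : C / √v ≤ C * w := by
    rw [div_eq_mul_inv, hw, Real.sqrt_eq_rpow, ← Real.rpow_neg hv0.le]
    gcongr
  have hCv : C / √v ≤ (1 - θ) / 2 := by
    have : 2 * C / (1 - θ) ≤ √v := Real.le_sqrt_of_sq_le hv'
    rw [div_le_iff₀ hθ1] at this
    rw [div_le_iff₀ (Real.sqrt_pos.2 hv0)]
    linarith
  have hθA : A * θ ≤ A := mul_le_of_le_one_right hA0 (by linarith)
  calc (1 + A * (2 * v) ^ (-b)) * ρ ≤ (1 + A * (θ * w)) * (1 + C / √v) := by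
        rw [Real.mul_rpow two_pos.le hv0.le]
        gcongr
    _ = 1 + A * (θ * w) + C / √v + A * θ * w * (C / √v) := by ring
    _ ≤ 1 + A * (θ * w) + A * (1 - θ) / 2 * w + A * w * ((1 - θ) / 2) := by
        gcongr
        exact hCw.trans (by gcongr)
    _ = 1 + A * w := by ring

lemma exists_one_add_rpow_mul_le {C : ℝ} (hb : 0 < b) (hb' : b ≤ 1 / 2) (hC : 0 ≤ C) :
    ∃ A : ℝ, 0 < A ∧ ∀ v ρ : ℝ, 0 < v → ρ ≤ 2 ^ (b / 2) → ρ ≤ 1 + C / √v →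
      (1 + A * (2 * v) ^ (-b)) * ρ ≤ 1 + A * v ^ (-b) := by
  set κ : ℝ := 2 * C / (1 - 2 ^ (-b))
  set v₁ : ℝ := max 1 (κ ^ 2)
  have : 0 < v₁ := lt_max_of_lt_left one_pos
  have hθ : 0 < 1 - (2 : ℝ) ^ (-(b / 2)) :=
    sub_pos.2 (Real.rpow_lt_one_of_one_lt_of_neg one_lt_two (by linarith))
  refine ⟨max (v₁ ^ b / (1 - 2 ^ (-(b / 2)))) κ, lt_max_of_lt_left (by positivity),
    fun v ρ hv hρ hρsqrt => ?_⟩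
  rcases le_total v v₁ with h | h
  · exact one_add_rpow_mul_le_of_le hb (by linarith) hv h (le_max_left _ _) hρ
  · exact one_add_rpow_mul_le_of_ge hb hb' hC ((le_max_left _ _).trans h)
      ((le_max_right _ _).trans h) (le_max_right _ _) hρsqrt

/-- The factors that are not close to `1` number about `-log₂ v`, and each of them is at most
`2 ^ (b / 2)`. -/
lemma exists_prod_le_one_add_rpow {C : ℝ} (hb : 0 < b) (hb' : b ≤ 1 / 2) (hC : 0 ≤ C) :
    ∃ A : ℝ, 0 < A ∧ ∀ (n : ℕ) (v : ℝ) (ρ : ℕ → ℝ), 0 < v → (∀ j, 0 ≤ ρ j) →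
      (∀ j, ρ j ≤ 2 ^ (b / 2)) → (∀ j, ρ j ≤ 1 + C / √(2 ^ j * v)) →
      ∏ j ∈ Finset.range n, ρ j ≤ 1 + A * v ^ (-b) := by
  obtain ⟨A, hA, hstep⟩ := exists_one_add_rpow_mul_le hb hb' hC
  refine ⟨A, hA, fun n => ?_⟩
  induction n with
  | zero =>
    intro v _ hv _ _ _
    simpa using mul_nonneg hA.le (Real.rpow_nonneg hv.le (-b))
  | succ n ih =>
    intro v ρ hv h0 hβ hC
    have htail := ih (2 * v) (fun j => ρ (j + 1)) (by linarith) (fun j => h0 _) (fun j => hβ _)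
      fun j => by simpa only [pow_succ, mul_assoc] using hC (j + 1)
    calc _ = (∏ j ∈ Finset.range n, ρ (j + 1)) * ρ 0 := Finset.prod_range_succ' _ _
      _ ≤ (1 + A * (2 * v) ^ (-b)) * ρ 0 := mul_le_mul_of_nonneg_right htail (h0 0)
      _ ≤ 1 + A * v ^ (-b) := hstep v (ρ 0) hv (hβ 0) (by simpa using hC 0)

end SlowProduct

section Frostman

open Metric

variable {X : Type*}

lemma exists_pos_ediam_add_rpow_lt {α : ℝ} [PseudoEMetricSpace X] {s : Set X} (hα : 0 ≤ α)
    (hs : ediam s ≠ ⊤) {δ : ENNReal} (hδ : δ ≠ 0) :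
    ∃ η : NNReal, 0 < η ∧ (ediam s + 2 * η) ^ α < ediam s ^ α + δ := by
  have hcont : Continuous fun η : NNReal => (ediam s + 2 * (η : ENNReal)) ^ α :=
    ENNReal.continuous_rpow_const.comp (continuous_const.add
      ((ENNReal.continuous_const_mul (by simp)).comp ENNReal.continuous_coe))
  have hzero : (ediam s + 2 * ((0 : NNReal) : ENNReal)) ^ α < ediam s ^ α + δ := by
    simpa using ENNReal.lt_add_right (ENNReal.rpow_ne_top_of_nonneg hα hs) hδ
  have hnear : ∀ᶠ η in nhdsWithin 0 (Set.Ioi 0),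
      (ediam s + 2 * ((η : NNReal) : ENNReal)) ^ α < ediam s ^ α + δ :=
    nhdsWithin_le_nhds (hcont.continuousAt.eventually_lt continuousAt_const hzero)
  exact (eventually_mem_nhdsWithin.and hnear).exists

lemma exists_cover_of_hausdorffMeasure_eq_zero {α : ℝ} [EMetricSpace X] [MeasurableSpace X]
    [BorelSpace X] (hα : 0 < α) {K : Set X} (hK : Measure.hausdorffMeasure α K = 0) {δ : ENNReal}
    (hδ : δ ≠ 0) :
    ∃ t : ℕ → Set X, K ⊆ ⋃ i, t i ∧ (∀ i, ediam (t i) ≤ 1) ∧ ∑' i, ediam (t i) ^ α < δ := by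
  rw [Measure.hausdorffMeasure_apply] at hK
  have hinf : (⨅ (t : ℕ → Set X) (_ : K ⊆ ⋃ n, t n) (_ : ∀ n, ediam (t n) ≤ 1),
      ∑' n, ⨆ _ : (t n).Nonempty, ediam (t n) ^ α) < δ :=
    ((iSup₂_eq_bot.1 hK) 1 zero_lt_one).trans_lt (pos_iff_ne_zero.2 hδ)
  simp only [iInf_lt_iff] at hinf
  obtain ⟨t, htK, htd, hts⟩ := hinf
  refine ⟨t, htK, htd, hts.trans_eq' (tsum_congr fun i => ?_)⟩
  rcases (t i).eq_empty_or_nonempty with h | h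
  · simp [h, hα]
  · simp [h]

lemma exists_open_cover_of_hausdorffMeasure_eq_zero {α : ℝ} [EMetricSpace X]
    [MeasurableSpace X] [BorelSpace X] (hα : 0 < α) {K : Set X}
    (hK : Measure.hausdorffMeasure α K = 0) {δ : ENNReal} (hδ : δ ≠ 0) :
    ∃ (U : ℕ → Set X) (d : ℕ → ENNReal), (∀ i, IsOpen (U i)) ∧ K ⊆ ⋃ i, U i ∧
      (∀ i, ediam (U i) ≤ d i) ∧ (∀ i, d i ≠ 0) ∧ (∀ i, d i ≠ ⊤) ∧ ∑' i, d i ^ α ≤ δ := by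
  have hδ2 : δ / 2 ≠ 0 := by simpa using hδ
  obtain ⟨t, htK, htd, hts⟩ := exists_cover_of_hausdorffMeasure_eq_zero hα hK hδ2
  have htop (i : ℕ) : ediam (t i) ≠ ⊤ := ((htd i).trans_lt ENNReal.one_lt_top).ne
  obtain ⟨ε, hε0, hε⟩ := ENNReal.exists_pos_sum_of_countable hδ2 ℕ
  choose η hη0 hη using fun i => exists_pos_ediam_add_rpow_lt hα.le (htop i)
    (ENNReal.coe_ne_zero.2 (hε0 i).ne')
  refine ⟨fun i => thickening (η i) (t i), fun i => ediam (t i) + 2 * η i,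
    fun i => isOpen_thickening, ?_, fun i => ediam_thickening_le _, fun i => ?_, fun i => ?_, ?_⟩
  · exact htK.trans (Set.iUnion_mono fun i => self_subset_thickening (by exact_mod_cast hη0 i) _)
  · simp [(hη0 i).ne']
  · exact ENNReal.add_ne_top.2 ⟨htop i, by finiteness⟩
  · calc ∑' i, (ediam (t i) + 2 * (η i : ENNReal)) ^ α ≤ ∑' i, (ediam (t i) ^ α + ε i) :=
        ENNReal.tsum_le_tsum fun i => (hη i).le
      _ = ∑' i, ediam (t i) ^ α + ∑' i, (ε i : ENNReal) := ENNReal.tsum_add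
      _ ≤ δ / 2 + δ / 2 := add_le_add hts.le hε.le
      _ = δ := ENNReal.add_halves δ

/-- The Riesz energy of dimension `α` of a measure; for `α > 0` the kernel is infinite on the
diagonal, so that a measure of finite energy has no atoms. -/
def energy [EDist X] [MeasurableSpace X] (α : ℝ) (ν : Measure X) : ENNReal :=
  ∫⁻ x, ∫⁻ y, edist x y ^ (-α) ∂ν ∂ν

lemma measure_sq_le_rpow_mul_lintegral_edist [PseudoEMetricSpace X] [MeasurableSpace X] {α : ℝ}
    (hα : 0 ≤ α) (ν : Measure X) {V : Set X} (hV : MeasurableSet V) {d : ENNReal}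
    (hVd : ediam V ≤ d) (hd0 : d ≠ 0) (hdt : d ≠ ⊤) :
    ν V ^ 2 ≤ d ^ α * ∫⁻ x in V, ∫⁻ y, edist x y ^ (-α) ∂ν ∂ν := by
  have hkernel {x y : X} (hx : x ∈ V) (hy : y ∈ V) : 1 ≤ d ^ α * edist x y ^ (-α) :=
    calc (1 : ENNReal) = d ^ α * d ^ (-α) := by
          rw [← ENNReal.rpow_add _ _ hd0 hdt, add_neg_cancel, ENNReal.rpow_zero]
      _ ≤ d ^ α * edist x y ^ (-α) := by
          rw [ENNReal.rpow_neg, ENNReal.rpow_neg]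
          gcongr
          exact (edist_le_ediam_of_mem hx hy).trans hVd
  have hdα : d ^ α ≠ ⊤ := ENNReal.rpow_ne_top_of_nonneg hα hdt
  calc ν V ^ 2 = ∫⁻ _ in V, ∫⁻ _ in V, 1 ∂ν ∂ν := by simp [sq]
    _ ≤ ∫⁻ x in V, ∫⁻ y in V, d ^ α * edist x y ^ (-α) ∂ν ∂ν :=
      setLIntegral_mono' hV fun x hx => setLIntegral_mono' hV fun y hy => hkernel hx hy
    _ ≤ ∫⁻ x in V, ∫⁻ y, d ^ α * edist x y ^ (-α) ∂ν ∂ν :=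
      lintegral_mono fun x => setLIntegral_le_lintegral _ _
    _ = d ^ α * ∫⁻ x in V, ∫⁻ y, edist x y ^ (-α) ∂ν ∂ν := by
      simp_rw [lintegral_const_mul' _ _ hdα]

lemma tsum_sq_le_tsum_mul_tsum {f g h : ℕ → ENNReal} (hfg : ∀ i, h i ^ 2 ≤ f i * g i) :
    (∑' i, h i) ^ 2 ≤ (∑' i, f i) * ∑' i, g i := by
  have hroot (i : ℕ) : h i ≤ f i ^ (2⁻¹ : ℝ) * g i ^ (2⁻¹ : ℝ) := by
    rw [← ENNReal.mul_rpow_of_nonneg _ _ (by norm_num), ENNReal.le_rpow_inv_iff two_pos]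
    exact_mod_cast hfg i
  have hholder : ∑' i, h i ≤ (∑' i, f i) ^ (2⁻¹ : ℝ) * (∑' i, g i) ^ (2⁻¹ : ℝ) := by
    refine (ENNReal.tsum_le_tsum hroot).trans ?_
    simp only [← lintegral_count]
    exact ENNReal.lintegral_mul_norm_pow_le (measurable_of_countable _).aemeasurable
      (measurable_of_countable _).aemeasurable (by norm_num) (by norm_num) (by norm_num)
  rw [← ENNReal.mul_rpow_of_nonneg _ _ (by norm_num), ENNReal.le_rpow_inv_iff two_pos] at hholder
  exact_mod_cast hholder

lemma measure_univ_sq_le_tsum_mul_energy [PseudoEMetricSpace X] [MeasurableSpace X]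
    [OpensMeasurableSpace X] {α : ℝ} (hα : 0 ≤ α) (ν : Measure X) {U : ℕ → Set X}
    {d : ℕ → ENNReal} (hU : ∀ i, IsOpen (U i)) (hUd : ∀ i, ediam (U i) ≤ d i)
    (hd0 : ∀ i, d i ≠ 0) (hdt : ∀ i, d i ≠ ⊤) (hν : ν (⋃ i, U i)ᶜ = 0) :
    ν Set.univ ^ 2 ≤ (∑' i, d i ^ α) * energy α ν := by
  have hVm (i : ℕ) : MeasurableSet (disjointed U i) :=
    MeasurableSet.disjointed (fun i => (hU i).measurableSet) i
  calc ν Set.univ ^ 2 = ν (⋃ i, disjointed U i) ^ 2 := by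
        rw [iUnion_disjointed, ← measure_add_measure_compl (s := ⋃ i, U i)
          (MeasurableSet.iUnion fun i => (hU i).measurableSet), hν, add_zero]
    _ ≤ (∑' i, ν (disjointed U i)) ^ 2 := by gcongr; exact measure_iUnion_le _
    _ ≤ (∑' i, d i ^ α) * ∑' i, ∫⁻ x in disjointed U i, ∫⁻ y, edist x y ^ (-α) ∂ν ∂ν :=
      tsum_sq_le_tsum_mul_tsum fun i => measure_sq_le_rpow_mul_lintegral_edist hα ν (hVm i)
        ((ediam_mono (disjointed_subset U i)).trans (hUd i)) (hd0 i) (hdt i)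
    _ ≤ (∑' i, d i ^ α) * energy α ν := by
      rw [← lintegral_iUnion hVm (disjoint_disjointed U)]
      gcongr
      exact setLIntegral_le_lintegral _ _

/-- Only the closures of the sets `A n` are compact, whence the exceptional set `D`. -/
lemma le_dimH_of_energy_le [EMetricSpace X] [MeasurableSpace X] [BorelSpace X] {α : NNReal}
    (hα : 0 < α) {A : ℕ → Set X} (hA : Antitone A) (hAc : ∀ n, IsCompact (closure (A n)))
    {D : Set X} (hD : D.Countable) (hcl : (⋂ n, closure (A n)) ⊆ (⋂ n, A n) ∪ D)
    {ν : ℕ → Measure X} (hν : ∀ n, ν n (A n)ᶜ = 0) {m C : ENNReal} (hm : m ≠ 0) (hC : C ≠ ⊤)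
    (h : ∃ᶠ n in atTop, m ≤ ν n Set.univ ∧ energy α (ν n) ≤ C) :
    (α : ENNReal) ≤ dimH (⋂ n, A n) := by
  by_contra! hlt
  have hα' : (0 : ℝ) < α := hα
  have hK : dimH (⋂ n, closure (A n)) < α := by
    refine (dimH_mono hcl).trans_lt ?_
    rw [dimH_union, dimH_countable hD]
    exact max_lt hlt (by exact_mod_cast hα)
  obtain ⟨δ, hδ0, hδ⟩ : ∃ δ : NNReal, 0 < δ ∧ δ * C < m ^ 2 :=
    ENNReal.exists_nnreal_pos_mul_lt hC (pow_ne_zero 2 hm)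
  obtain ⟨U, d, hUo, hKU, hUd, hd0, hdt, hds⟩ := exists_open_cover_of_hausdorffMeasure_eq_zero
    hα' (hausdorffMeasure_of_dimH_lt hK) (ENNReal.coe_ne_zero.2 hδ0.ne')
  have hanti : Antitone fun n => closure (A n) := fun _ _ hmn => closure_mono (hA hmn)
  obtain ⟨n₀, hn₀⟩ := exists_subset_nhds_of_isCompact hanti.directed_ge hAc
    (fun x hx => (isOpen_iUnion hUo).mem_nhds (hKU hx))
  obtain ⟨n, hn, hmass, henergy⟩ := (frequently_atTop.1 h) n₀
  have hsub : A n ⊆ ⋃ i, U i := (hA hn).trans (subset_closure.trans hn₀)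
  refine hδ.not_ge ?_
  calc m ^ 2 ≤ ν n Set.univ ^ 2 := by gcongr
    _ ≤ (∑' i, d i ^ (α : ℝ)) * energy α (ν n) :=
      measure_univ_sq_le_tsum_mul_energy hα'.le (ν n) hUo hUd hd0 hdt
        (measure_mono_null (Set.compl_subset_compl.2 hsub) (hν n))
    _ ≤ δ * C := by gcongr

end Frostman

lemma lintegral_ball_edist_rpow_neg {E : Type*} [NormedAddCommGroup E] [MeasurableSpace E]
    [BorelSpace E] (μ : Measure E) [μ.IsAddLeftInvariant] (β : ℝ) (s : E) (r : ℝ) :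
    ∫⁻ t in Metric.ball s r, edist s t ^ (-β) ∂μ =
      ∫⁻ u in Metric.ball (0 : E) r, ‖u‖ₑ ^ (-β) ∂μ := by
  rw [← (measurePreserving_add_left μ s).setLIntegral_comp_preimage_emb
    (Homeomorph.addLeft s).measurableEmbedding]
  simp [edist_eq_enorm_sub]

section RieszKernel

variable {E : Type*} [NormedAddCommGroup E] [NormedSpace ℝ E] [FiniteDimensional ℝ E]
  [Nontrivial E] [MeasurableSpace E] [BorelSpace E] (μ : Measure E) [μ.IsAddHaarMeasure]

lemma lintegral_ball_enorm_rpow_neg_lt_top {β : ℝ} (hβ : β < Module.finrank ℝ E) (r : ℝ) :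
    ∫⁻ u in Metric.ball (0 : E) r, ‖u‖ₑ ^ (-β) ∂μ < ⊤ := by
  have hint : IntegrableOn (fun u : E => ‖u‖ ^ (-β)) (Metric.ball 0 r) μ :=
    integrableOn_ball_of_norm_le_rpow Module.finrank_pos (C := 1) hβ
      (Eventually.of_forall fun u => by rw [one_mul, Real.norm_of_nonneg (by positivity)])
      (measurable_norm.pow_const (-β)).aestronglyMeasurable
  refine (lintegral_congr_ae (ae_restrict_of_ae ?_)).trans_lt hint.2
  filter_upwards [Measure.ae_ne μ 0] with u hu
  have hu0 : 0 < ‖u‖ := norm_pos_iff.2 hu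
  rw [Real.enorm_of_nonneg (by positivity), ← ENNReal.ofReal_rpow_of_pos hu0, ofReal_norm]

lemma exists_lintegral_edist_rpow_neg_le {β : ℝ} (hβ : β < Module.finrank ℝ E) {K : Set E}
    (hK : Bornology.IsBounded K) :
    ∃ C : ENNReal, C ≠ ⊤ ∧ ∀ s ∈ K, ∫⁻ t in K, edist s t ^ (-β) ∂μ ≤ C := by
  obtain ⟨r, hr⟩ := Metric.isBounded_iff.1 hK
  refine ⟨_, (lintegral_ball_enorm_rpow_neg_lt_top μ hβ (r + 1)).ne, fun s hs => ?_⟩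
  rw [← lintegral_ball_edist_rpow_neg]
  exact lintegral_mono_set fun t ht => (hr ht hs).trans_lt (lt_add_one r)

lemma energy_restrict_ne_top {β : ℝ} (hβ : β < Module.finrank ℝ E) {K : Set E}
    (hK : Bornology.IsBounded K) (hKm : MeasurableSet K) : energy β (μ.restrict K) ≠ ⊤ := by
  obtain ⟨C, hC, hle⟩ := exists_lintegral_edist_rpow_neg_le μ hβ hK
  refine ne_top_of_le_ne_top (ENNReal.mul_ne_top hC (hK.measure_lt_top (μ := μ)).ne) ?_
  calc energy β (μ.restrict K) ≤ ∫⁻ _ in K, C ∂μ := setLIntegral_mono' hKm hle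
    _ = C * μ K := setLIntegral_const K C

end RieszKernel

section RandomDensity

lemma measurable_edist_rpow {X : Type*} [PseudoEMetricSpace X] [SecondCountableTopology X]
    [MeasurableSpace X] [OpensMeasurableSpace X] (a : ℝ) :
    Measurable fun p : X × X => edist p.1 p.2 ^ a :=
  measurable_edist.pow_const a

lemma edist_rpow_neg_mul {X : Type*} [EMetricSpace X] {a b : ℝ} (ha : 0 < a) (hb : 0 < b)
    (s t : X) : edist s t ^ (-a) * edist s t ^ (-b) = edist s t ^ (-(a + b)) := by
  rcases eq_or_ne s t with rfl | hst
  · simp only [edist_self, ENNReal.zero_rpow_of_neg, neg_lt_zero, ha, hb, add_pos,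
      ENNReal.top_mul_top]
  rcases eq_or_ne (edist s t) ⊤ with htop | htop
  · simp only [htop, ENNReal.top_rpow_of_neg, neg_lt_zero, ha, hb, add_pos, mul_zero]
  · rw [neg_add, ENNReal.rpow_add _ _ (edist_pos.2 hst).ne' htop]

lemma two_mul_add_one_tsub_sq_le (m : ENNReal) : 2 * m + (1 - m) ^ 2 ≤ m ^ 2 + 1 := by
  rcases le_total m 1 with h | h
  · obtain ⟨r, hr⟩ := exists_add_of_le h
    have hsub : 1 - m = r := by
      rw [hr, ENNReal.add_sub_cancel_left (h.trans_lt ENNReal.one_lt_top).ne]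
    refine le_of_eq ?_
    calc 2 * m + (1 - m) ^ 2 = 2 * m * (m + r) + r ^ 2 := by rw [hsub, ← hr, mul_one]
      _ = m ^ 2 + (m + r) ^ 2 := by ring
      _ = m ^ 2 + 1 := by rw [← hr, one_pow]
  · obtain ⟨r, rfl⟩ := exists_add_of_le h
    calc 2 * (1 + r) + (1 - (1 + r)) ^ 2 = 2 * (1 + r) := by
          rw [tsub_eq_zero_of_le le_self_add, zero_pow two_ne_zero, add_zero]
      _ ≤ 2 * (1 + r) + r ^ 2 := le_self_add
      _ = (1 + r) ^ 2 + 1 := by ring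

variable {Ω : Type*} {mΩ : MeasurableSpace Ω} {P : Measure Ω}

lemma measure_lt_half_le [IsProbabilityMeasure P] {m : Ω → ENNReal} (hm : Measurable m)
    (mean : ∫⁻ ω, m ω ∂P = 1) {ε : ENNReal} (hsq : ∫⁻ ω, m ω ^ 2 ∂P ≤ 1 + ε) :
    P {ω | m ω < 1 / 2} ≤ 4 * ε := by
  have hvar : ∫⁻ ω, (1 - m ω) ^ 2 ∂P ≤ ε := by
    have hint := lintegral_mono (μ := P) fun ω => two_mul_add_one_tsub_sq_le (m ω)
    rw [lintegral_add_left (hm.const_mul 2), lintegral_const_mul 2 hm, mean,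
      lintegral_add_right _ measurable_const, lintegral_const, measure_univ, mul_one,
      mul_one] at hint
    refine (ENNReal.add_le_add_iff_left (a := 2) ENNReal.ofNat_ne_top).1 (hint.trans ?_)
    calc _ ≤ 1 + ε + 1 := by gcongr
      _ = 2 + ε := by ring
  calc P {ω | m ω < 1 / 2} ≤ P {ω | 1 / 4 ≤ (1 - m ω) ^ 2} := by
        refine measure_mono fun ω (hω : m ω < 1 / 2) => ?_
        have hhalf : 1 / 2 ≤ 1 - m ω := by
          refine ENNReal.le_sub_of_add_le_left hω.ne_top ?_
          calc m ω + 1 / 2 ≤ 1 / 2 + 1 / 2 := by gcongr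
            _ = 1 := ENNReal.add_halves 1
        calc (1 / 4 : ENNReal) = (1 / 2) ^ 2 := by
              rw [one_div, one_div, ← ENNReal.inv_pow]
              norm_num
          _ ≤ (1 - m ω) ^ 2 := by gcongr
    _ ≤ (∫⁻ ω, (1 - m ω) ^ 2 ∂P) / (1 / 4) :=
        meas_ge_le_lintegral_div ((measurable_const.sub hm).pow_const 2).aemeasurable
          (by simp) (by simp)
    _ ≤ ε / (1 / 4) := by gcongr
    _ = 4 * ε := by rw [one_div, ENNReal.div_eq_inv_mul, inv_inv]

lemma measure_eventually_mem_le {B : ℕ → Set Ω} {κ : ENNReal} (h : ∀ n, P (B n) ≤ κ) :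
    P {ω | ∀ᶠ n in atTop, ω ∈ B n} ≤ κ := by
  have hset : {ω | ∀ᶠ n in atTop, ω ∈ B n} = ⋃ N, ⋂ n ≥ N, B n := by
    ext ω
    simp [eventually_atTop]
  have hmono : Monotone fun N => ⋂ n ≥ N, B n :=
    fun N M hNM => Set.biInter_subset_biInter_left fun n (hn : M ≤ n) => hNM.trans hn
  rw [hset, hmono.measure_iUnion]
  exact iSup_le fun N => (measure_mono (Set.biInter_subset_of_mem le_rfl)).trans (h N)

variable {X : Type*} [MeasurableSpace X] {μ : Measure X} [SFinite μ]

lemma energy_withDensity [PseudoEMetricSpace X] [SecondCountableTopology X]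
    [OpensMeasurableSpace X] (α : ℝ) {g : X → ENNReal} (hg : Measurable g) :
    energy α (μ.withDensity g) = ∫⁻ s, ∫⁻ t, edist s t ^ (-α) * (g s * g t) ∂μ ∂μ := by
  have hk (s : X) : Measurable fun t => edist s t ^ (-α) :=
    (measurable_edist_rpow (-α)).comp measurable_prodMk_left
  rw [energy, lintegral_withDensity_eq_lintegral_mul _ hg
    (measurable_edist_rpow (-α)).lintegral_prod_right']
  refine lintegral_congr fun s => ?_
  rw [Pi.mul_apply, lintegral_withDensity_eq_lintegral_mul _ hg (hk s),
    ← lintegral_const_mul _ (hg.mul (hk s))]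
  refine lintegral_congr fun t => ?_
  rw [Pi.mul_apply]
  ring

section Correlation

variable [SFinite P] {f : X → Ω → ENNReal} (hf : Measurable fun p : X × Ω => f p.1 p.2)
  {κ : X → X → ENNReal} (hκ : Measurable fun p : X × X => κ p.1 p.2)

include hf hκ

lemma measurable_kernel_mul_mul :
    Measurable fun p : (Ω × X) × X => κ p.1.2 p.2 * (f p.1.2 p.1.1 * f p.2 p.1.1) :=
  (hκ.comp (by fun_prop : Measurable fun p : (Ω × X) × X => (p.1.2, p.2))).mul
    ((hf.comp (by fun_prop : Measurable fun p : (Ω × X) × X => (p.1.2, p.1.1))).mul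
      (hf.comp (by fun_prop : Measurable fun p : (Ω × X) × X => (p.2, p.1.1))))

lemma measurable_lintegral_lintegral_mul :
    Measurable fun ω => ∫⁻ s, ∫⁻ t, κ s t * (f s ω * f t ω) ∂μ ∂μ :=
  (measurable_kernel_mul_mul hf hκ).lintegral_prod_right'.lintegral_prod_right'

lemma lintegral_lintegral_lintegral_mul_le {G : X → X → ENNReal}
    (hG : ∀ᵐ s ∂μ, ∀ᵐ t ∂μ, ∫⁻ ω, f s ω * f t ω ∂P ≤ G s t) :
    ∫⁻ ω, ∫⁻ s, ∫⁻ t, κ s t * (f s ω * f t ω) ∂μ ∂μ ∂P ≤ ∫⁻ s, ∫⁻ t, κ s t * G s t ∂μ ∂μ := by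
  have hint := measurable_kernel_mul_mul hf hκ
  rw [lintegral_lintegral_swap hint.lintegral_prod_right'.aemeasurable]
  refine lintegral_mono_ae ?_
  filter_upwards [hG] with s hs
  have hint_s : Measurable fun p : Ω × X => κ s p.2 * (f s p.1 * f p.2 p.1) :=
    hint.comp (by fun_prop : Measurable fun p : Ω × X => ((p.1, s), p.2))
  rw [lintegral_lintegral_swap hint_s.aemeasurable]
  refine lintegral_mono_ae ?_
  filter_upwards [hs] with t ht
  have hfs (u : X) : Measurable fun ω => f u ω := hf.comp measurable_prodMk_left
  have hmul : Measurable fun ω => f s ω * f t ω := (hfs s).mul (hfs t)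
  rw [lintegral_const_mul _ hmul]
  gcongr

end Correlation

section SecondMoment

variable [IsProbabilityMeasure P] [EMetricSpace X] [SecondCountableTopology X]
  [OpensMeasurableSpace X] {f : X → Ω → ENNReal}
  (hf : Measurable fun p : X × Ω => f p.1 p.2) {δ : ENNReal} {b : ℝ}
  (hcorr : ∀ᵐ s ∂μ, ∀ᵐ t ∂μ, ∫⁻ ω, f s ω * f t ω ∂P ≤ 1 + δ * edist s t ^ (-b))

include hf hcorr

lemma lintegral_sq_lintegral_le [IsProbabilityMeasure μ] :
    ∫⁻ ω, (∫⁻ s, f s ω ∂μ) ^ 2 ∂P ≤ 1 + δ * energy b μ := by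
  have hsq (ω : Ω) : (∫⁻ s, f s ω ∂μ) ^ 2 = ∫⁻ s, ∫⁻ t, 1 * (f s ω * f t ω) ∂μ ∂μ := by
    have hfω : Measurable fun s => f s ω := hf.comp measurable_prodMk_right
    simp only [one_mul, sq, lintegral_const_mul _ hfω, lintegral_mul_const _ hfω]
  have hedist := measurable_edist_rpow (X := X) (-b)
  simp only [hsq]
  refine (lintegral_lintegral_lintegral_mul_le hf measurable_const hcorr).trans_eq ?_
  have hinner (s : X) : ∫⁻ t, 1 * (1 + δ * edist s t ^ (-b)) ∂μ =
      1 + δ * ∫⁻ t, edist s t ^ (-b) ∂μ := by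
    have hs : Measurable fun t => edist s t ^ (-b) := hedist.comp measurable_prodMk_left
    simp only [one_mul]
    rw [lintegral_add_left measurable_const, lintegral_const_mul _ hs, lintegral_const,
      measure_univ, one_mul]
  simp only [hinner]
  rw [lintegral_add_left measurable_const, lintegral_const_mul _ hedist.lintegral_prod_right',
    lintegral_const, measure_univ, one_mul, energy]

lemma lintegral_energy_withDensity_le {α : ℝ} (hα : 0 < α) (hb : 0 < b) :
    ∫⁻ ω, energy α (μ.withDensity fun s => f s ω) ∂P ≤ energy α μ + δ * energy (α + b) μ := by
  have hfω (ω : Ω) : Measurable fun s => f s ω := hf.comp measurable_prodMk_right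
  have hedist (β : ℝ) := measurable_edist_rpow (X := X) β
  have hedist_right (s : X) (β : ℝ) : Measurable fun t => edist s t ^ β :=
    (hedist β).comp measurable_prodMk_left
  simp only [fun ω => energy_withDensity α (hfω ω) (μ := μ)]
  refine (lintegral_lintegral_lintegral_mul_le hf (hedist (-α)) hcorr).trans_eq ?_
  have hinner (s : X) : ∫⁻ t, edist s t ^ (-α) * (1 + δ * edist s t ^ (-b)) ∂μ =
      ∫⁻ t, edist s t ^ (-α) ∂μ + δ * ∫⁻ t, edist s t ^ (-(α + b)) ∂μ := by
    simp only [mul_add, mul_one, mul_left_comm _ δ, edist_rpow_neg_mul hα hb]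
    rw [lintegral_add_left (hedist_right s _), lintegral_const_mul _ (hedist_right s _)]
  simp only [hinner]
  rw [lintegral_add_left (hedist (-α)).lintegral_prod_right',
    lintegral_const_mul _ (hedist (-(α + b))).lintegral_prod_right', energy, energy]

lemma measure_lintegral_lt_half_le [IsProbabilityMeasure μ]
    (hmean : ∀ s, ∫⁻ ω, f s ω ∂P = 1) :
    P {ω | ∫⁻ s, f s ω ∂μ < 1 / 2} ≤ 4 * (δ * energy b μ) := by
  have hswap : Measurable fun p : Ω × X => f p.2 p.1 := hf.comp measurable_swap
  refine measure_lt_half_le hswap.lintegral_prod_right' ?_ (lintegral_sq_lintegral_le hf hcorr)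
  rw [lintegral_lintegral_swap hswap.aemeasurable]
  simp only [hmean, lintegral_const, measure_univ, mul_one]

lemma measure_not_half_le_mass_and_energy_le [IsProbabilityMeasure μ] {α : ℝ} (hα : 0 < α)
    (hb : 0 < b) (hmean : ∀ s, ∫⁻ ω, f s ω ∂P = 1) {L : ENNReal} (hL : L ≠ 0) (hL' : L ≠ ⊤) :
    P {ω | ¬(1 / 2 ≤ μ.withDensity (fun s => f s ω) Set.univ ∧
        energy α (μ.withDensity fun s => f s ω) ≤ L)} ≤
      4 * (δ * energy b μ) + (energy α μ + δ * energy (α + b) μ) / L := by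
  have hfω (ω : Ω) : Measurable fun s => f s ω := hf.comp measurable_prodMk_right
  have henergy : Measurable fun ω => energy α (μ.withDensity fun s => f s ω) := by
    simp only [fun ω => energy_withDensity α (hfω ω) (μ := μ)]
    exact measurable_lintegral_lintegral_mul hf (measurable_edist_rpow (-α))
  refine (measure_mono (t := {ω | ∫⁻ s, f s ω ∂μ < 1 / 2} ∪
    {ω | L ≤ energy α (μ.withDensity fun s => f s ω)}) fun ω hω => ?_).trans
      ((measure_union_le _ _).trans (add_le_add (measure_lintegral_lt_half_le hf hcorr hmean) ?_))
  · simp only [Set.mem_ofPred_eq, not_and_or, not_le, withDensity_apply _ MeasurableSet.univ,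
      Measure.restrict_univ] at hω
    exact hω.imp id le_of_lt
  · refine (meas_ge_le_lintegral_div henergy.aemeasurable hL hL').trans ?_
    gcongr
    exact lintegral_energy_withDensity_le hf hcorr hα hb

end SecondMoment

/-- Random measures with densities `f n` of mean one, carried by decreasing random sets `A n`, have
mass bounded below and energy bounded above for infinitely many `n`, outside an event that the
correlations control; Frostman's argument then applies to the intersection. -/
theorem measure_not_le_dimH_iInter_le [IsProbabilityMeasure P] [IsProbabilityMeasure μ]
    [EMetricSpace X] [SecondCountableTopology X] [BorelSpace X] {f : ℕ → X → Ω → ENNReal}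
    (hf : ∀ n, Measurable fun p : X × Ω => f n p.1 p.2)
    (hmean : ∀ n s, ∫⁻ ω, f n s ω ∂P = 1) {δ : ENNReal} (hδ : δ ≠ ⊤) {b : ℝ} (hb : 0 < b)
    (hcorr : ∀ n, ∀ᵐ s ∂μ, ∀ᵐ t ∂μ, ∫⁻ ω, f n s ω * f n t ω ∂P ≤ 1 + δ * edist s t ^ (-b))
    {α : NNReal} (hα : 0 < α) (hEα : energy α μ ≠ ⊤) (hEαb : energy (α + b) μ ≠ ⊤)
    {A : Ω → ℕ → Set X} (hA : ∀ ω, Antitone (A ω)) (hAc : ∀ ω n, IsCompact (closure (A ω n)))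
    {D : Ω → Set X} (hD : ∀ ω, (D ω).Countable)
    (hcl : ∀ᵐ ω ∂P, (⋂ n, closure (A ω n)) ⊆ (⋂ n, A ω n) ∪ D ω)
    (hsupp : ∀ n ω, ∀ᵐ s ∂μ, f n s ω ≠ 0 → s ∈ A ω n) :
    P {ω | ¬ (α : ENNReal) ≤ dimH (⋂ n, A ω n)} ≤ 4 * (δ * energy b μ) := by
  set E : ENNReal := energy α μ + δ * energy (α + b) μ
  have hE_top : E ≠ ⊤ := ENNReal.add_ne_top.2 ⟨hEα, ENNReal.mul_ne_top hδ hEαb⟩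
  let ν (n : ℕ) (ω : Ω) : Measure X := μ.withDensity fun s => f n s ω
  have hν (n : ℕ) (ω : Ω) : ν n ω (A ω n)ᶜ = 0 := by
    have hfω : Measurable fun s => f n s ω := (hf n).comp measurable_prodMk_right
    rw [withDensity_apply_eq_zero hfω]
    refine measure_mono_null (fun s hs => ?_) (hsupp n ω)
    exact fun himp => hs.2 (himp hs.1)
  have hbound (L : ℕ) (hL : L ≠ 0) :
      P {ω | ¬ (α : ENNReal) ≤ dimH (⋂ n, A ω n)} ≤ 4 * (δ * energy b μ) + E / L := by
    refine le_trans (measure_mono_ae ?_) (measure_eventually_mem_le fun n =>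
      measure_not_half_le_mass_and_energy_le (hf n) (hcorr n) (α := α) (mod_cast hα) hb (hmean n)
        (Nat.cast_ne_zero.2 hL) (ENNReal.natCast_ne_top L))
    filter_upwards [hcl] with ω hclω hdim
    by_contra hoften
    refine hdim (le_dimH_of_energy_le hα (hA ω) (hAc ω) (hD ω) hclω (fun n => hν n ω)
      (m := 1 / 2) (by simp) (ENNReal.natCast_ne_top L) ?_)
    exact (not_eventually.1 hoften).mono fun n hn => not_not.1 hn
  have hlim : Tendsto (fun L : ℕ => 4 * (δ * energy b μ) + E / L) atTop
      (nhds (4 * (δ * energy b μ) + 0)) := by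
    refine tendsto_const_nhds.add ?_
    simpa only [ENNReal.div_top] using
      ENNReal.Tendsto.const_div ENNReal.tendsto_nat_nhds_top (Or.inr hE_top)
  rw [add_zero] at hlim
  exact ge_of_tendsto hlim ((eventually_ne_atTop 0).mono hbound)

end RandomDensity

section Walker

instance {M : Type*} [Monoid M] [MeasurableSpace M] [DiscreteMeasurableSpace M] :
    DiscreteMeasurableSpace Mˣ where
  forall_measurableSet s := ⟨Units.val '' s, DiscreteMeasurableSpace.forall_measurableSet _,
    Set.preimage_image_eq _ Units.val_injective⟩

/-- The highest position visited in the first `n` steps from `z`. -/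
def record (ξ : Site → ℤˣ) (z : Site) : ℕ → ℤ
  | 0 => z.1.1
  | n + 1 => max (record ξ z n) (follow ξ z (n + 1)).1.1

/-- Position and record after `n` steps from `z`. -/
def walker (ξ : Site → ℤˣ) (z : Site) (n : ℕ) : ℤ × ℤ := ((follow ξ z n).1.1, record ξ z n)

lemma follow_level (ξ : Site → ℤˣ) (z : Site) (n : ℕ) : (follow ξ z n).1.2 = z.1.2 + n := by
  induction n with
  | zero => simp [follow]
  | succ n ih => simp only [follow, Site.next, ih]; push_cast; ring

lemma measurable_comp_of_countable {Ω ι β : Type*} {mΩ : MeasurableSpace Ω} [Countable ι]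
    [MeasurableSpace ι] [MeasurableSingletonClass ι] [MeasurableSpace β] {f : Ω → ι}
    (hf : Measurable f) {G : ι → Ω → β} (hG : ∀ u ∈ Set.range f, Measurable (G u)) :
    Measurable fun ω => G (f ω) ω := by
  intro B hB
  have hcover : (fun ω => G (f ω) ω) ⁻¹' B = ⋃ u ∈ Set.range f, f ⁻¹' {u} ∩ G u ⁻¹' B := by
    ext ω
    simp only [Set.mem_preimage, Set.mem_iUnion, Set.mem_inter_iff, Set.mem_singleton_iff]
    exact ⟨fun h => ⟨f ω, ⟨ω, rfl⟩, rfl, h⟩, fun ⟨_, _, h1, h2⟩ => h1 ▸ h2⟩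
  rw [hcover]
  exact MeasurableSet.biUnion (Set.to_countable _) fun u hu =>
    (hf (measurableSet_singleton u)).inter (hG u hu hB)

variable {Ω : Type*} {mΩ : MeasurableSpace Ω} {ξ : Ω → Site → ℤˣ} {z : Site} {n : ℕ}

lemma measurable_follow (h : ∀ u : Site, u.1.2 < z.1.2 + n → Measurable fun ω => ξ ω u) :
    Measurable fun ω => follow (ξ ω) z n := by
  induction n with
  | zero => exact measurable_const
  | succ n ih =>
    refine measurable_comp_of_countable (G := fun u ω => u.next (ξ ω u))
      (ih fun u hu => h u (by push_cast; omega)) ?_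
    rintro _ ⟨ω, rfl⟩
    refine (measurable_of_countable (follow (ξ ω) z n).next).comp (h _ ?_)
    rw [follow_level]
    push_cast
    omega

lemma measurable_walker (h : ∀ u : Site, u.1.2 < z.1.2 + n → Measurable fun ω => ξ ω u) :
    Measurable fun ω => walker (ξ ω) z n := by
  have hpos (k : ℕ) (hk : k ≤ n) : Measurable fun ω => (follow (ξ ω) z k).1.1 :=
    (measurable_of_countable fun u : Site => u.1.1).comp
      (measurable_follow fun u hu => h u (by omega))
  have hrec : ∀ k ≤ n, Measurable fun ω => record (ξ ω) z k := by
    intro k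
    induction k with
    | zero => exact fun _ => measurable_const
    | succ k ih => exact fun hk => (ih (by omega)).max (hpos _ hk)
  exact (hpos n le_rfl).prodMk (hrec n le_rfl)

/-- The two walkers that follow the two components of a configuration of pairs of arrows. -/
def walkerPair (ζ : Site → ℤˣ × ℤˣ) (z : Site) (n : ℕ) : (ℤ × ℤ) × (ℤ × ℤ) :=
  (walker (fun u => (ζ u).1) z n, walker (fun u => (ζ u).2) z n)

end Walker

section Markov

variable {Ω : Type*} {m mΩ : MeasurableSpace Ω} {P : Measure Ω}

lemma lintegral_eq_tsum_setLIntegral_fiber {ι : Type*} [Countable ι] [MeasurableSpace ι]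
    [MeasurableSingletonClass ι] {X : Ω → ι} (hX : Measurable X) (F : Ω → ENNReal) :
    ∫⁻ ω, F ω ∂P = ∑' i, ∫⁻ ω in X ⁻¹' {i}, F ω ∂P := by
  rw [← lintegral_iUnion (fun i => hX (measurableSet_singleton i))
    fun i j hij => Disjoint.preimage X (Set.disjoint_singleton.2 hij), ← Set.preimage_iUnion,
    Set.iUnion_of_singleton, Set.preimage_univ, setLIntegral_univ]

lemma lintegral_mul_comp_of_indep {ι : Type*} [Countable ι] [MeasurableSpace ι]
    [MeasurableSingletonClass ι] (hm : m ≤ mΩ) {X : Ω → ι}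
    (hX : Measurable[m] X) {H : Ω → ENNReal} (hH : Measurable[m] H) {G : ι → Ω → ENNReal}
    (hG : ∀ i, Measurable (G i))
    (hindep : ∀ i ∈ Set.range X, Indep m (MeasurableSpace.comap (G i) inferInstance) P) :
    ∫⁻ ω, H ω * G (X ω) ω ∂P = ∫⁻ ω, H ω * ∫⁻ ω', G (X ω) ω' ∂P ∂P := by
  have hXm : Measurable X := hX.mono hm le_rfl
  rw [lintegral_eq_tsum_setLIntegral_fiber hXm, lintegral_eq_tsum_setLIntegral_fiber hXm]
  refine tsum_congr fun i => ?_
  by_cases hi : i ∈ Set.range X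
  swap
  · simp [Set.preimage_singleton_eq_empty.2 hi]
  have hfib : MeasurableSet[m] (X ⁻¹' {i}) := hX (measurableSet_singleton i)
  calc ∫⁻ ω in X ⁻¹' {i}, H ω * G (X ω) ω ∂P = ∫⁻ ω in X ⁻¹' {i}, H ω * G i ω ∂P :=
        setLIntegral_congr_fun (hm _ hfib) fun ω (hω : X ω = i) => by simp only [hω]
    _ = ∫⁻ ω, (X ⁻¹' {i}).indicator H ω * G i ω ∂P := by
        simp only [← lintegral_indicator (hm _ hfib), Set.indicator_mul_left]
    _ = (∫⁻ ω in X ⁻¹' {i}, H ω ∂P) * ∫⁻ ω', G i ω' ∂P := by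
        rw [lintegral_mul_eq_lintegral_mul_lintegral_of_independent_measurableSpace hm
          (hG i).comap_le (hindep i hi) (hH.indicator hfib) (comap_measurable (G i)),
          lintegral_indicator (hm _ hfib)]
    _ = ∫⁻ ω in X ⁻¹' {i}, H ω * ∫⁻ ω', G (X ω) ω' ∂P ∂P := by
        rw [← lintegral_mul_const _ (hH.mono hm le_rfl)]
        exact setLIntegral_congr_fun (hm _ hfib) fun ω (hω : X ω = i) => by simp only [hω]

lemma StepChain.lintegral_next {S α : Type*} [Fintype α] [MeasurableSpace α]
    [MeasurableSingletonClass α] (M : StepChain S α) {σ : S} {e : Ω → α} (he : Measurable e)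
    (hlaw : ∀ a, P {ω | e ω = a} = ENNReal.ofReal (M.weight σ a)) {g : S → ℝ}
    (hg : ∀ σ, 0 ≤ g σ) :
    ∫⁻ ω, ENNReal.ofReal (g (M.next σ (e ω))) ∂P = ENNReal.ofReal (M.avg g σ) := by
  rw [M.avg_apply, ENNReal.ofReal_sum_of_nonneg fun a _ => mul_nonneg (M.weight_nonneg σ a) (hg _),
    ← lintegral_map (f := fun a => ENNReal.ofReal (g (M.next σ a))) (measurable_of_finite _) he,
    lintegral_fintype]
  refine Finset.sum_congr rfl fun a _ => ?_
  rw [Measure.map_apply he (measurableSet_singleton a), ENNReal.ofReal_mul (M.weight_nonneg σ a),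
    ← hlaw, mul_comm]
  rfl

end Markov

section PairField

variable {Ω : Type*} {η : Site → Ω → ℤˣ × ℤˣ}

/-- The information carried by the signs below a level. -/
abbrev below (η : Site → Ω → ℤˣ × ℤˣ) (l : ℤ) : MeasurableSpace Ω :=
  ⨆ z ∈ {z : Site | z.1.2 < l}, MeasurableSpace.comap (η z) inferInstance

lemma below_mono (η : Site → Ω → ℤˣ × ℤˣ) : Monotone (below η) := fun _ _ h =>
  biSup_mono fun _ hz => lt_of_lt_of_le hz h

lemma measurable_below {l : ℤ} {z : Site} (h : z.1.2 < l) : Measurable[below η l] (η z) :=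
  (comap_measurable (η z)).mono (le_biSup (fun z => MeasurableSpace.comap (η z) inferInstance) h)
    le_rfl

lemma measurable_walkerPair_below (η : Site → Ω → ℤˣ × ℤˣ) (z : Site) (n : ℕ) :
    Measurable[below η (z.1.2 + n)] fun ω => walkerPair (η · ω) z n :=
  (measurable_walker fun _ hu => measurable_fst.comp (measurable_below hu)).prodMk
    (measurable_walker fun _ hu => measurable_snd.comp (measurable_below hu))

variable [mΩ : MeasurableSpace Ω] {P : Measure Ω} {q : unitInterval}

/-- A field of independent pairs of symmetric signs on the lattice, which differ with
probability `q`. -/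
structure IsPairField (P : Measure Ω) (q : unitInterval) (η : Site → Ω → ℤˣ × ℤˣ) : Prop where
  measurable : ∀ z, Measurable (η z)
  indep : iIndepFun η P
  law : ∀ z a b, P {ω | η z ω = (a, b)} = ENNReal.ofReal (coinWeight q a b)

namespace IsPairField

variable (h : IsPairField P q η)
include h

lemma below_le (l : ℤ) : below η l ≤ mΩ := iSup₂_le fun z _ => (h.measurable z).comap_le

lemma measure_preimage_coe (u : Site) (s : Finset (ℤˣ × ℤˣ)) :
    P (η u ⁻¹' s) = ENNReal.ofReal (∑ e ∈ s, coinWeight q e.1 e.2) := by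
  rw [ENNReal.ofReal_sum_of_nonneg fun e _ => coinWeight_nonneg q e.1 e.2,
    ← sum_measure_preimage_singleton s fun e _ => h.measurable u (measurableSet_singleton e)]
  exact Finset.sum_congr rfl fun e _ => h.law u e.1 e.2

lemma measure_fst (u : Site) (a : ℤˣ) : P {ω | (η u ω).1 = a} = ENNReal.ofReal (1 / 2) := by
  have hset : {ω | (η u ω).1 = a} = η u ⁻¹' ({a} ×ˢ Finset.univ : Finset (ℤˣ × ℤˣ)) := by
    ext ω
    simp only [Set.mem_ofPred_eq, Set.mem_preimage, Finset.mem_coe, Finset.mem_product,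
      Finset.mem_singleton, Finset.mem_univ, and_true]
  rw [hset, h.measure_preimage_coe, Finset.sum_product, Finset.sum_singleton,
    sum_coinWeight_right]

lemma measure_snd (u : Site) (b : ℤˣ) : P {ω | (η u ω).2 = b} = ENNReal.ofReal (1 / 2) := by
  have hset : {ω | (η u ω).2 = b} = η u ⁻¹' (Finset.univ ×ˢ {b} : Finset (ℤˣ × ℤˣ)) := by
    ext ω
    simp only [Set.mem_ofPred_eq, Set.mem_preimage, Finset.mem_coe, Finset.mem_product,
      Finset.mem_singleton, Finset.mem_univ, true_and]
  rw [hset, h.measure_preimage_coe, Finset.sum_product_right, Finset.sum_singleton,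
    sum_coinWeight_left]

lemma measure_pair {u v : Site} (huv : u.1.2 = v.1.2) {σ : (ℤ × ℤ) × (ℤ × ℤ)}
    (hu : σ.1.1 = u.1.1) (hv : σ.2.1 = v.1.1) (e : ℤˣ × ℤˣ) :
    P {ω | ((η u ω).1, (η v ω).2) = e} = ENNReal.ofReal ((pairChain q).weight σ e) := by
  by_cases hx : u.1.1 = v.1.1
  · obtain rfl : u = v := Subtype.ext (Prod.ext hx huv)
    simp only [pairChain, if_pos (hu.trans hv.symm)]
    exact h.law u e.1 e.2
  · have hind := h.indep.indepFun fun huv : u = v => hx (by rw [huv])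
    have hset : {ω | ((η u ω).1, (η v ω).2) = e} =
      η u ⁻¹' (Prod.fst ⁻¹' {e.1}) ∩ η v ⁻¹' (Prod.snd ⁻¹' {e.2}) := by
      ext ω; exact Prod.ext_iff
    have hne : σ.1.1 ≠ σ.2.1 := by rwa [hu, hv]
    simp only [hset, pairChain, if_neg hne]
    rw [hind.measure_inter_preimage_eq_mul _ _
      (measurable_fst (measurableSet_singleton e.1)) (measurable_snd (measurableSet_singleton e.2))]
    calc P {ω | (η u ω).1 = e.1} * P {ω | (η v ω).2 = e.2} = ENNReal.ofReal (1 / 2 * (1 / 2)) := by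
          rw [h.measure_fst, h.measure_snd, ENNReal.ofReal_mul (by norm_num)]
      _ = ENNReal.ofReal (1 / 4) := by norm_num

lemma indep_below_step {l : ℤ} {u v : Site} (hu : u.1.2 = l) (hv : v.1.2 = l)
    (φ : ℤˣ × ℤˣ → ENNReal) :
    Indep (below η l)
      (MeasurableSpace.comap (fun ω => φ ((η u ω).1, (η v ω).2)) inferInstance) P := by
  have hdisj : Disjoint {z : Site | z.1.2 < l} {z : Site | z.1.2 = l} :=
    Set.disjoint_left.2 fun z h1 h2 => h1.ne h2
  refine indep_of_indep_of_le_right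
    (indep_iSup_of_disjoint (fun z => (h.measurable z).comap_le) h.indep hdisj)
    (Measurable.comap_le ?_)
  have hm {z : Site} (hz : z.1.2 = l) : Measurable[⨆ z ∈ {z : Site | z.1.2 = l},
      MeasurableSpace.comap (η z) inferInstance] (η z) :=
    (comap_measurable (η z)).mono
      (le_biSup (fun z => MeasurableSpace.comap (η z) inferInstance) hz) le_rfl
  exact (measurable_of_countable φ).comp
    ((measurable_fst.comp (hm hu)).prodMk (measurable_snd.comp (hm hv)))

lemma lintegral_walkerPair_succ (z : Site) (n : ℕ) {g : (ℤ × ℤ) × (ℤ × ℤ) → ℝ}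
    (hg : ∀ σ, 0 ≤ g σ) {H : Ω → ENNReal} (hH : Measurable[below η (z.1.2 + n)] H) :
    ∫⁻ ω, H ω * ENNReal.ofReal (g (walkerPair (η · ω) z (n + 1))) ∂P =
      ∫⁻ ω, H ω * ENNReal.ofReal ((pairChain q).avg g (walkerPair (η · ω) z n)) ∂P := by
  set X : Ω → Site × Site × ((ℤ × ℤ) × (ℤ × ℤ)) := fun ω =>
    (follow (fun u => (η u ω).1) z n, follow (fun u => (η u ω).2) z n, walkerPair (η · ω) z n)
  have hX : Measurable[below η (z.1.2 + n)] X :=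
    (measurable_follow fun _ hu => measurable_fst.comp (measurable_below hu)).prodMk
      ((measurable_follow fun _ hu => measurable_snd.comp (measurable_below hu)).prodMk
        (measurable_walkerPair_below η z n))
  set G : Site × Site × ((ℤ × ℤ) × (ℤ × ℤ)) → Ω → ENNReal := fun x ω =>
    ENNReal.ofReal (g ((pairChain q).next x.2.2 ((η x.1 ω).1, (η x.2.1 ω).2)))
  have hsigns (u v : Site) : Measurable[mΩ] fun ω => ((η u ω).1, (η v ω).2) :=
    (h.measurable u).fst.prodMk (h.measurable v).snd
  calc _ = ∫⁻ ω, H ω * G (X ω) ω ∂P := rfl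
    _ = ∫⁻ ω, H ω * ∫⁻ ω', G (X ω) ω' ∂P ∂P := by
      refine lintegral_mul_comp_of_indep (h.below_le _) hX hH (fun x =>
        (measurable_of_countable fun e => ENNReal.ofReal (g ((pairChain q).next x.2.2 e))).comp
          (hsigns x.1 x.2.1)) ?_
      rintro _ ⟨ω, rfl⟩
      exact h.indep_below_step (follow_level _ _ _) (follow_level _ _ _)
        fun e => ENNReal.ofReal (g ((pairChain q).next _ e))
    _ = _ := lintegral_congr fun ω => by
      congr 1
      exact (pairChain q).lintegral_next (hsigns _ _)
        (h.measure_pair (by rw [follow_level, follow_level]) rfl rfl) hg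

lemma lintegral_walkerPair (z : Site) (n : ℕ) {g : (ℤ × ℤ) × (ℤ × ℤ) → ℝ} (hg : ∀ σ, 0 ≤ g σ)
    {H : Ω → ENNReal} (hH : Measurable[below η z.1.2] H) :
    ∫⁻ ω, H ω * ENNReal.ofReal (g (walkerPair (η · ω) z n)) ∂P =
      (∫⁻ ω, H ω ∂P) *
        ENNReal.ofReal (((pairChain q).avg ^ n) g ((z.1.1, z.1.1), (z.1.1, z.1.1))) := by
  induction n generalizing g with
  | zero => exact lintegral_mul_const (μ := P) (ENNReal.ofReal
      (g ((z.1.1, z.1.1), (z.1.1, z.1.1)))) (hH.mono (h.below_le _) le_rfl)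
  | succ n ih =>
    have hg' : ∀ σ, 0 ≤ (pairChain q).avg g σ := by
      simpa only [pow_one] using (pairChain q).avg_pow_nonneg hg 1
    rw [h.lintegral_walkerPair_succ z n hg (hH.mono (below_mono η (by omega)) le_rfl), ih hg',
      StepChain.avg_pow_succ]

lemma lintegral_prod_walkerPair [IsProbabilityMeasure P] {z : ℕ → Site} {N : ℕ → ℕ}
    (hz : ∀ j, (z (j + 1)).1.2 = (z j).1.2 + N j) {g : ℕ → (ℤ × ℤ) × (ℤ × ℤ) → ℝ}
    (hg : ∀ j σ, 0 ≤ g j σ) (J : ℕ) :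
    ∫⁻ ω, ∏ j ∈ Finset.range J, ENNReal.ofReal (g j (walkerPair (η · ω) (z j) (N j))) ∂P =
      ∏ j ∈ Finset.range J, ENNReal.ofReal (((pairChain q).avg ^ N j) (g j)
        (((z j).1.1, (z j).1.1), ((z j).1.1, (z j).1.1))) := by
  have hmono : Monotone fun j => (z j).1.2 := monotone_nat_of_le_succ fun j => by
    rw [hz]; omega
  induction J with
  | zero => simp
  | succ J ih =>
    simp_rw [Finset.prod_range_succ]
    rw [h.lintegral_walkerPair (z J) (N J) (hg J), ih]
    refine Finset.measurable_fun_prod _ fun j hj => ?_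
    have hle : below η ((z j).1.2 + N j) ≤ below η (z J).1.2 :=
      below_mono η (by rw [← hz]; exact hmono (Finset.mem_range.1 hj))
    exact (measurable_of_countable fun σ => ENNReal.ofReal (g j σ)).comp
      ((measurable_walkerPair_below η (z j) (N j)).mono hle le_rfl)

end IsPairField

end PairField

section Clock

instance : IsProbabilityMeasure (expMeasure 1) := isProbabilityMeasure_expMeasure one_pos

instance : IsProbabilityMeasure (uniformOn (Set.univ : Set ℤˣ)) :=
  isProbabilityMeasure_uniformOn Set.finite_univ Set.univ_nonempty

/-- Law of a waiting time and the sign drawn with it. -/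
abbrev tickLaw : Measure (ℝ × ℤˣ) := (expMeasure 1).prod (uniformOn (Set.univ : Set ℤˣ))

/-- Law of the waiting times and signs at one site. -/
abbrev clockLaw : Measure (ℕ → ℝ × ℤˣ) := Measure.infinitePi fun _ => tickLaw

/-- Time of the ring number `n` of a clock, where `ringTime` has a whole field of clocks. -/
def clockTime (x : ℕ → ℝ × ℤˣ) (n : ℕ) : ℝ := ∑ k ∈ Finset.range (n + 1), (x k).1

/-- Number of rings of a clock until `τ`. -/
def clockCount (τ : ℝ) (x : ℕ → ℝ × ℤˣ) : ℕ := {n : ℕ | clockTime x n ≤ τ}.ncard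

/-- Sign shown by a clock at time `τ`. -/
def clockSign (τ : ℝ) (x : ℕ → ℝ × ℤˣ) : ℤˣ := (x (clockCount τ x)).2

lemma measurable_clockTime (n : ℕ) : Measurable fun x => clockTime x n := by
  unfold clockTime
  fun_prop

lemma measurable_uncurry_clockCount :
    Measurable fun p : ℝ × (ℕ → ℝ × ℤˣ) => clockCount p.1 p.2 :=
  measurable_ncard.comp (measurable_set_iff.2 fun n => measurableSet_setOfPred.1
    (measurableSet_le ((measurable_clockTime n).comp measurable_snd) measurable_fst))

lemma measurable_uncurry_clockSign : Measurable fun p : ℝ × (ℕ → ℝ × ℤˣ) => clockSign p.1 p.2 :=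
  measurable_comp_of_countable (G := fun n p => (p.2 n).2) measurable_uncurry_clockCount
    fun n _ => by fun_prop

lemma measurable_clockCount (τ : ℝ) : Measurable (clockCount τ) := by
  simpa only [Function.comp_def] using
    measurable_uncurry_clockCount.comp (measurable_prodMk_left (x := τ))

lemma measurable_clockSign (τ : ℝ) : Measurable (clockSign τ) := by
  simpa only [Function.comp_def] using
    measurable_uncurry_clockSign.comp (measurable_prodMk_left (x := τ))

/-- The sequences of waiting times of genuine clocks, whose rings are ordered and do not
accumulate. -/
structure Regular (x : ℕ → ℝ × ℤˣ) : Prop where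
  pos : ∀ k, 0 < (x k).1
  tendsto : Tendsto (clockTime x) atTop atTop

lemma monotone_clockTime {x : ℕ → ℝ × ℤˣ} (hx : ∀ k, 0 < (x k).1) : Monotone (clockTime x) :=
  monotone_nat_of_le_succ fun n => by
    rw [clockTime, clockTime, Finset.sum_range_succ _ (n + 1)]
    exact le_add_of_nonneg_right (hx (n + 1)).le

lemma Regular.finite {x : ℕ → ℝ × ℤˣ} (hx : Regular x) (τ : ℝ) :
    {n | clockTime x n ≤ τ}.Finite := by
  have hlt := hx.tendsto.eventually_gt_atTop τ
  rw [← Nat.cofinite_eq_atTop, eventually_cofinite] at hlt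
  simpa only [not_lt] using hlt

lemma Regular.clockCount_eq_zero_iff {x : ℕ → ℝ × ℤˣ} (hx : Regular x) {τ : ℝ} :
    clockCount τ x = 0 ↔ τ < (x 0).1 := by
  have hzero : clockTime x 0 = (x 0).1 := by simp [clockTime]
  rw [clockCount, Set.ncard_eq_zero (hx.finite τ), Set.eq_empty_iff_forall_notMem]
  simp only [Set.mem_ofPred_eq, not_le]
  exact ⟨fun h => hzero ▸ h 0, fun h n =>
    (hzero ▸ h).trans_le (monotone_clockTime hx.pos n.zero_le)⟩

lemma Regular.eventually_clockSign_eq {x : ℕ → ℝ × ℤˣ} (hx : Regular x) {τ : ℝ}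
    (hτ : ∀ n, clockTime x n ≠ τ) : ∀ᶠ τ' in nhds τ, clockSign τ' x = clockSign τ x := by
  have hiff : ∀ᶠ τ' in nhds τ, ∀ n ∈ {n | clockTime x n ≤ τ + 1},
      (clockTime x n ≤ τ' ↔ clockTime x n ≤ τ) := by
    rw [eventually_all_finite (hx.finite (τ + 1))]
    intro n _
    rcases lt_or_gt_of_ne (hτ n) with h | h
    · filter_upwards [lt_mem_nhds h] with τ' h'
      exact iff_of_true h'.le h.le
    · filter_upwards [gt_mem_nhds h] with τ' h'
      exact iff_of_false (not_le.2 h') (not_le.2 h)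
  filter_upwards [hiff, gt_mem_nhds (lt_add_one τ)] with τ' hiff' hτ'
  have hcount : {n | clockTime x n ≤ τ'} = {n | clockTime x n ≤ τ} := by
    ext n
    by_cases hn : clockTime x n ≤ τ + 1
    · exact hiff' n hn
    · exact iff_of_false (fun h => hn (h.trans hτ'.le)) fun h => hn (h.trans (lt_add_one τ).le)
  rw [clockSign, clockSign, clockCount, hcount, clockCount]

end Clock

section ClockLaw

lemma expMeasure_Ioc {r : ℝ} (hr : 0 < r) {s t : ℝ} (hs : 0 ≤ s) (hst : s ≤ t) :
    expMeasure r (Set.Ioc s t) = ENNReal.ofReal (Real.exp (-(r * s)) - Real.exp (-(r * t))) := by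
  have := isProbabilityMeasure_expMeasure hr
  rw [← measure_cdf (expMeasure r), StieltjesFunction.measure_Ioc, cdf_expMeasure_eq hr,
    cdf_expMeasure_eq hr, if_pos hs, if_pos (hs.trans hst)]
  ring_nf

lemma expMeasure_Ioi {r : ℝ} (hr : 0 < r) {x : ℝ} (hx : 0 ≤ x) :
    expMeasure r (Set.Ioi x) = ENNReal.ofReal (Real.exp (-(r * x))) := by
  have := isProbabilityMeasure_expMeasure hr
  have hcdf : 0 ≤ 1 - Real.exp (-(r * x)) :=
    sub_nonneg.2 (Real.exp_le_one_iff.2 (neg_nonpos.2 (by positivity)))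
  rw [← Set.compl_Iic, prob_compl_eq_one_sub measurableSet_Iic, ← ofReal_cdf, cdf_expMeasure_eq hr,
    if_pos hx, ← ENNReal.ofReal_one, ← ENNReal.ofReal_sub _ hcdf, sub_sub_cancel]

lemma ae_infinitePi_exists_mem {X : Type*} [MeasurableSpace X] {μ : Measure X}
    [IsProbabilityMeasure μ] {s : Set X} (hs : MeasurableSet s) (hμ : μ s ≠ 0) :
    ∀ᵐ x ∂Measure.infinitePi fun _ : ℕ => μ, ∃ k, x k ∈ s := by
  have hlt : μ sᶜ < 1 := by
    rw [prob_compl_eq_one_sub hs]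
    exact ENNReal.sub_lt_self ENNReal.one_ne_top one_ne_zero hμ
  have hle (n : ℕ) : Measure.infinitePi (fun _ : ℕ => μ) {x | ¬∃ k, x k ∈ s} ≤ μ sᶜ ^ n :=
    calc _ ≤ Measure.infinitePi (fun _ : ℕ => μ) (Set.pi (Finset.range n) fun _ => sᶜ) :=
          measure_mono fun x hx k _ => not_exists.1 hx k
      _ = μ sᶜ ^ n := by
          rw [Measure.infinitePi_pi (fun _ : ℕ => μ) fun _ _ => hs.compl, Finset.prod_const,
            Finset.card_range]
  exact le_antisymm
    (ge_of_tendsto' (ENNReal.tendsto_pow_atTop_nhds_zero_of_lt_one hlt) hle) zero_le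

lemma tickLaw_fst_preimage (B : Set ℝ) : tickLaw (Prod.fst ⁻¹' B) = expMeasure 1 B := by
  rw [tickLaw, ← Set.prod_univ, Measure.prod_prod, measure_univ, mul_one]

lemma clockLaw_wait_mem (k : ℕ) {B : Set ℝ} (hB : MeasurableSet B) :
    clockLaw {x | (x k).1 ∈ B} = expMeasure 1 B := by
  rw [← tickLaw_fst_preimage, ← Measure.infinitePi_map_eval (fun _ : ℕ => tickLaw) k,
    Measure.map_apply (by fun_prop) (measurable_fst hB)]
  rfl

lemma ae_regular : ∀ᵐ x ∂clockLaw, Regular x := by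
  have hpos : ∀ᵐ x ∂clockLaw, ∀ k, 0 < (x k).1 := ae_all_iff.2 fun k => by
    refine (prob_compl_eq_zero_iff (measurableSet_lt (by fun_prop) (by fun_prop))).2 ?_
    refine (clockLaw_wait_mem k measurableSet_Ioi).trans ?_
    simp [expMeasure_Ioi]
  have hlong : ∀ᵐ x ∂clockLaw, ∀ M : ℕ, ∃ k, (M : ℝ) < (x k).1 := ae_all_iff.2 fun M => by
    refine ae_infinitePi_exists_mem (s := Prod.fst ⁻¹' Set.Ioi (M : ℝ))
      (measurable_fst measurableSet_Ioi) ?_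
    rw [tickLaw_fst_preimage, expMeasure_Ioi one_pos M.cast_nonneg]
    exact (ENNReal.ofReal_pos.2 (Real.exp_pos _)).ne'
  filter_upwards [hpos, hlong] with x hpos hlong
  refine ⟨hpos, tendsto_atTop_atTop_of_monotone (monotone_clockTime hpos) fun b => ?_⟩
  obtain ⟨M, hM⟩ := exists_nat_ge b
  obtain ⟨k, hk⟩ := hlong M
  exact ⟨k, (hM.trans hk.le).trans (Finset.single_le_sum (f := fun i => (x i).1)
    (fun i _ => (hpos i).le) (Finset.self_mem_range_succ k))⟩

end ClockLaw

section Flip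

/-- The transformation of a clock that changes the signs drawn with the ticks in `S` and keeps the
waiting times. -/
def flipSigns (S : Set ℕ) [DecidablePred (· ∈ S)] (x : ℕ → ℝ × ℤˣ) (k : ℕ) : ℝ × ℤˣ :=
  if k ∈ S then ((x k).1, -(x k).2) else x k

variable (S : Set ℕ) [DecidablePred (· ∈ S)]

lemma measurePreserving_neg_uniformOn_univ :
    MeasurePreserving (fun a : ℤˣ => -a) (uniformOn Set.univ) (uniformOn Set.univ) := by
  refine ⟨measurable_of_countable _, Measure.ext_of_singleton fun a => ?_⟩
  have hpre : (fun a : ℤˣ => -a) ⁻¹' {a} = {-a} := by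
    ext b
    exact neg_eq_iff_eq_neg
  rw [Measure.map_apply (measurable_of_countable _) (measurableSet_singleton a), hpre,
    uniformOn_univ, uniformOn_univ, Measure.count_singleton, Measure.count_singleton]

lemma measurePreserving_flipSigns : MeasurePreserving (flipSigns S) clockLaw clockLaw := by
  have hneg : MeasurePreserving (fun y : ℝ × ℤˣ => (y.1, -y.2)) tickLaw tickLaw :=
    (MeasurePreserving.id _).prod measurePreserving_neg_uniformOn_univ
  have hflip (k : ℕ) : MeasurePreserving (fun y : ℝ × ℤˣ => if k ∈ S then (y.1, -y.2) else y)
      tickLaw tickLaw := by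
    by_cases h : k ∈ S
    · simpa only [h, if_true] using hneg
    · simp only [h, if_false]
      exact MeasurePreserving.id _
  refine ⟨measurable_pi_iff.2 fun k => (hflip k).measurable.comp (measurable_pi_apply k), ?_⟩
  refine (Measure.infinitePi_map_pi (fun _ : ℕ => tickLaw) fun k => (hflip k).measurable).trans ?_
  simp only [(hflip _).map_eq]

lemma clockCount_flipSigns (τ : ℝ) (x : ℕ → ℝ × ℤˣ) :
    clockCount τ (flipSigns S x) = clockCount τ x := by
  have hfst (k : ℕ) : (flipSigns S x k).1 = (x k).1 := by unfold flipSigns; split_ifs <;> rfl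
  simp only [clockCount, clockTime, hfst]

lemma clockSign_flipSigns (τ : ℝ) (x : ℕ → ℝ × ℤˣ) :
    clockSign τ (flipSigns S x) = if clockCount τ x ∈ S then -clockSign τ x else clockSign τ x := by
  rw [clockSign, clockCount_flipSigns, flipSigns, clockSign]
  split_ifs <;> rfl

end Flip

section FlipProb

/-- Probability that a clock shows different signs at two times. -/
def flipProb (s t : ℝ) : unitInterval :=
  ⟨clockLaw.real {x | clockSign s x ≠ clockSign t x}, measureReal_nonneg, measureReal_le_one⟩

lemma flipProb_comm (s t : ℝ) : flipProb s t = flipProb t s := by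
  simp only [flipProb, ne_comm]

lemma measureReal_pair_eq_coinWeight {Ω : Type*} [MeasurableSpace Ω] {P : Measure Ω}
    [IsProbabilityMeasure P] {X Y : Ω → ℤˣ} (hX : Measurable X) (hY : Measurable Y)
    (hsymm : ∀ a b, P.real {ω | (X ω, Y ω) = (-a, -b)} = P.real {ω | (X ω, Y ω) = (a, b)})
    {q : unitInterval} (hq : P.real {ω | X ω ≠ Y ω} = q) (a b : ℤˣ) :
    P.real {ω | (X ω, Y ω) = (a, b)} = coinWeight q a b := by
  have hmeas (e : ℤˣ × ℤˣ) : MeasurableSet {ω | (X ω, Y ω) = e} :=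
    (hX.prodMk hY) (measurableSet_singleton e)
  have hdisj : Disjoint {ω | (X ω, Y ω) = (a, b)} {ω | (X ω, Y ω) = (-a, -b)} :=
    Set.disjoint_left.2 fun ω h h' =>
      units_ne_neg_self a (congrArg Prod.fst ((h : _ = _).symm.trans h'))
  have hunion := measureReal_union (μ := P) hdisj (hmeas _)
  rw [hsymm] at hunion
  have hunits : ∀ x y a b : ℤˣ, (x, y) = (a, b) ∨ (x, y) = (-a, -b) ↔ (x = y ↔ a = b) := by decide
  have hmem : {ω | (X ω, Y ω) = (a, b)} ∪ {ω | (X ω, Y ω) = (-a, -b)} =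
      {ω | X ω = Y ω ↔ a = b} := Set.ext fun ω => hunits (X ω) (Y ω) a b
  have hNm : MeasurableSet {ω | X ω ≠ Y ω} := (measurableSet_eq_fun hX hY).compl
  unfold coinWeight
  split_ifs with hab
  · have hset : {ω | X ω = Y ω ↔ a = b} = {ω | X ω ≠ Y ω}ᶜ := by
      ext ω
      simp [hab]
    rw [hmem, hset, probReal_compl_eq_one_sub hNm, hq] at hunion
    linarith
  · have hset : {ω | X ω = Y ω ↔ a = b} = {ω | X ω ≠ Y ω} := by
      ext ω
      simp [hab]
    rw [hmem, hset, hq] at hunion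
    linarith

lemma clockLaw_pair (s t : ℝ) (a b : ℤˣ) :
    clockLaw {x | (clockSign s x, clockSign t x) = (a, b)} =
      ENNReal.ofReal (coinWeight (flipProb s t) a b) := by
  rw [← ofReal_measureReal, measureReal_pair_eq_coinWeight (measurable_clockSign s)
    (measurable_clockSign t) (fun a b => ?_) (q := flipProb s t) rfl]
  have hm : MeasurableSet {x | (clockSign s x, clockSign t x) = (a, b)} :=
    ((measurable_clockSign s).prodMk (measurable_clockSign t)) (measurableSet_singleton (a, b))
  rw [← (measurePreserving_flipSigns Set.univ).measureReal_preimage hm.nullMeasurableSet]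
  congr 1
  ext x
  simp only [Set.mem_preimage, Set.mem_ofPred_eq, clockSign_flipSigns, Set.mem_univ, if_true,
    Prod.mk.injEq, neg_eq_iff_eq_neg]

/-- Given that the clock rings first between the two times, the signs shown are independent, since
the initial sign can be flipped. -/
lemma half_measureReal_clockCount_le_flipProb (s t : ℝ) :
    clockLaw.real {x | clockCount s x = 0 ∧ clockCount t x ≠ 0} / 2 ≤ flipProb s t := by
  set B : Set (ℕ → ℝ × ℤˣ) := {x | clockCount s x = 0 ∧ clockCount t x ≠ 0} with hB
  have hBm : MeasurableSet B := (measurable_clockCount s (measurableSet_singleton 0)).inter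
    (measurable_clockCount t (measurableSet_singleton 0)).compl
  set N : Set (ℕ → ℝ × ℤˣ) := {x | clockSign s x ≠ clockSign t x} with hN
  have hNm : MeasurableSet N :=
    (measurableSet_eq_fun (measurable_clockSign s) (measurable_clockSign t)).compl
  have hflip : clockLaw.real (B ∩ N) = clockLaw.real (B \ N) := by
    rw [← (measurePreserving_flipSigns {0}).measureReal_preimage (hBm.inter hNm).nullMeasurableSet]
    congr 1
    ext x
    simp only [hB, hN, Set.mem_preimage, Set.mem_inter_iff, Set.mem_ofPred_eq, Set.mem_sdiff,
      clockCount_flipSigns, not_not]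
    refine and_congr_right fun ⟨hs, ht⟩ => ?_
    simp only [clockSign_flipSigns, Set.mem_singleton_iff, hs, ht, if_true, if_false]
    generalize clockSign s x = a
    generalize clockSign t x = b
    revert a b
    decide
  have hsum : clockLaw.real (B ∩ N) + clockLaw.real (B \ N) = clockLaw.real B :=
    measureReal_inter_add_sdiff hNm
  have hle : clockLaw.real (B ∩ N) ≤ flipProb s t := measureReal_mono Set.inter_subset_right
  linarith

lemma le_measureReal_clockCount {s t : ℝ} (hs : 0 ≤ s) (hst : s ≤ t) :
    Real.exp (-t) * (t - s) ≤ clockLaw.real {x | clockCount s x = 0 ∧ clockCount t x ≠ 0} :=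
  calc Real.exp (-t) * (t - s) ≤ Real.exp (-t) * (Real.exp (t - s) - 1) := by
        refine mul_le_mul_of_nonneg_left ?_ (Real.exp_pos _).le
        linarith [Real.add_one_le_exp (t - s)]
    _ = Real.exp (-s) - Real.exp (-t) := by
        rw [mul_sub, mul_one, ← Real.exp_add]
        ring_nf
    _ ≤ clockLaw.real {x | (x 0).1 ∈ Set.Ioc s t} := by
        rw [measureReal_def, clockLaw_wait_mem 0 measurableSet_Ioc, expMeasure_Ioc one_pos hs hst,
          one_mul, one_mul]
        exact ENNReal.toReal_ofReal' ▸ le_max_left _ _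
    _ ≤ clockLaw.real {x | clockCount s x = 0 ∧ clockCount t x ≠ 0} := by
        refine ENNReal.toReal_mono (measure_ne_top _ _) (measure_mono_ae ?_)
        filter_upwards [ae_regular] with x hx hx0
        exact ⟨hx.clockCount_eq_zero_iff.2 hx0.1,
          fun h => (hx.clockCount_eq_zero_iff.1 h).not_ge hx0.2⟩

lemma le_flipProb {s t : ℝ} (hs : s ∈ Set.Icc (0 : ℝ) 1) (ht : t ∈ Set.Icc (0 : ℝ) 1) :
    Real.exp (-1) / 2 * |s - t| ≤ flipProb s t := by
  wlog hst : s ≤ t generalizing s t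
  · rw [abs_sub_comm, flipProb_comm]
    exact this ht hs (not_le.1 hst).le
  have hexp : Real.exp (-1) * (t - s) ≤ Real.exp (-t) * (t - s) :=
    mul_le_mul_of_nonneg_right (Real.exp_le_exp.2 (neg_le_neg ht.2)) (sub_nonneg.2 hst)
  rw [abs_sub_comm, abs_of_nonneg (sub_nonneg.2 hst)]
  linarith [le_measureReal_clockCount hs.1 hst, half_measureReal_clockCount_le_flipProb s t]

end FlipProb

section NonCrossing

variable (ξ : Site → ℤˣ)

lemma follow_add (z : Site) (m n : ℕ) :
    follow ξ z (m + n) = follow ξ (follow ξ z m) n := by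
  induction n with
  | zero => rfl
  | succ n ih => rw [← add_assoc, follow, follow, ih]

lemma follow_mono {u v : Site} (hlevel : u.1.2 = v.1.2) (huv : u.1.1 ≤ v.1.1) (n : ℕ) :
    (follow ξ u n).1.1 ≤ (follow ξ v n).1.1 := by
  induction n with
  | zero => exact huv
  | succ n ih =>
    have hlevel_n : (follow ξ u n).1.2 = (follow ξ v n).1.2 := by
      rw [follow_level, follow_level, hlevel]
    rcases ih.eq_or_lt with heq | hlt
    · rw [follow, follow, Subtype.ext (Prod.ext heq hlevel_n)]
    · -- By parity the two walks are at distance at least two, which one step cannot close.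
      obtain ⟨i, hi⟩ := (follow ξ u n).2
      obtain ⟨j, hj⟩ := (follow ξ v n).2
      have hξu := Int.units_eq_one_or (ξ (follow ξ u n))
      have hξv := Int.units_eq_one_or (ξ (follow ξ v n))
      simp only [follow, Site.next]
      rcases hξu with hξu | hξu <;> rcases hξv with hξv | hξv <;>
        simp only [hξu, hξv, Units.val_one, Units.val_neg] <;> omega

lemma follow_le_record (z : Site) {m n : ℕ} (h : m ≤ n) :
    (follow ξ z m).1.1 ≤ record ξ z n := by
  induction n, h using Nat.le_induction with
  | base =>
    cases m with
    | zero => exact le_rfl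
    | succ m => exact le_max_right _ _
  | succ n _ ih => exact ih.trans (le_max_left _ _)

lemma follow_add_le_record {z v : Site} {m n N : ℕ} (hlevel : v.1.2 = z.1.2 + m)
    (hv : (follow ξ z m).1.1 ≤ v.1.1) (hn : n ≤ N) :
    (follow ξ z (m + n)).1.1 ≤ record ξ v N := by
  rw [follow_add]
  exact (follow_mono ξ ((follow_level ξ z m).trans hlevel.symm) hv n).trans
    (follow_le_record ξ v hn)

variable {ξ} {z : ℕ → Site} {N : ℕ → ℕ} (hz : ∀ j, (z (j + 1)).1.2 = (z j).1.2 + N j)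
  (hrecord : ∀ j, record ξ (z j) (N j) ≤ (z (j + 1)).1.1)

include hz

lemma level_eq_add_sum (j : ℕ) : (z j).1.2 = (z 0).1.2 + (∑ i ∈ Finset.range j, N i : ℕ) := by
  induction j with
  | zero => simp
  | succ j ih => rw [hz, ih, Finset.sum_range_succ]; push_cast; ring

include hrecord

lemma follow_sum_le (j : ℕ) :
    (follow ξ (z 0) (∑ i ∈ Finset.range j, N i)).1.1 ≤ (z j).1.1 := by
  induction j with
  | zero => exact le_rfl
  | succ j ih =>
    rw [Finset.sum_range_succ]
    exact (follow_add_le_record ξ (level_eq_add_sum hz j) ih le_rfl).trans (hrecord j)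

lemma follow_sum_add_le (j : ℕ) {n : ℕ} (hn : n ≤ N j) :
    (follow ξ (z 0) (∑ i ∈ Finset.range j, N i + n)).1.1 ≤ (z (j + 1)).1.1 :=
  (follow_add_le_record ξ (level_eq_add_sum hz j) (follow_sum_le hz hrecord j) hn).trans
    (hrecord j)

end NonCrossing

section Blocks

/-- The number of walk steps in the block number `j` of the multiscale construction; `k` is the
scale at which the construction starts. -/
def blockTime (k j : ℕ) : ℕ := 4 ^ (k + j + 1)

/-- The height that a walk may gain during the block number `j`: `K` times the square root of its
duration. -/
def blockHeight (K k j : ℕ) : ℕ := K * 2 ^ (k + j + 1)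

lemma even_sum_blockHeight_add_sum_blockTime (K k j : ℕ) :
    Even (((∑ i ∈ Finset.range j, blockHeight K k i : ℕ) : ℤ) +
      (∑ i ∈ Finset.range j, blockTime k i : ℕ)) := by
  rw [← Nat.cast_add, Int.even_coe_nat, ← Finset.sum_add_distrib]
  refine even_iff_two_dvd.2 (Finset.dvd_sum fun i _ => dvd_add ?_ ?_)
  · exact (dvd_pow_self 2 (Nat.succ_ne_zero _)).mul_left K
  · exact (by norm_num : 2 ∣ 4).trans (dvd_pow_self 4 (Nat.succ_ne_zero _))

/-- The site from which the block number `j` starts: it is reached from the origin if every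
earlier block takes up all the height that it is allowed. -/
def blockStart (K k j : ℕ) : Site :=
  ⟨((∑ i ∈ Finset.range j, blockHeight K k i : ℕ), (∑ i ∈ Finset.range j, blockTime k i : ℕ)),
    even_sum_blockHeight_add_sum_blockTime K k j⟩

lemma blockStart_succ_fst (K k j : ℕ) :
    (blockStart K k (j + 1)).1.1 = (blockStart K k j).1.1 + blockHeight K k j := by
  simp only [blockStart, Finset.sum_range_succ, Nat.cast_add]

lemma blockStart_succ_level (K k j : ℕ) :
    (blockStart K k (j + 1)).1.2 = (blockStart K k j).1.2 + blockTime k j := by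
  simp only [blockStart, Finset.sum_range_succ, Nat.cast_add]

lemma sum_blockHeight_le (K k j : ℕ) :
    ∑ i ∈ Finset.range j, blockHeight K k i ≤ blockHeight K k j := by
  induction j with
  | zero => exact Nat.zero_le _
  | succ j ih =>
    calc ∑ i ∈ Finset.range (j + 1), blockHeight K k i ≤ blockHeight K k j + blockHeight K k j := by
          rw [Finset.sum_range_succ]; gcongr
      _ = blockHeight K k (j + 1) := by simp only [blockHeight]; ring

lemma blockHeight_pos {K : ℕ} (hK : 0 < K) (k j : ℕ) : (0 : ℝ) < blockHeight K k j := by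
  unfold blockHeight; positivity

lemma two_pow_le_sqrt_sum_blockTime (k j : ℕ) :
    (2 : ℝ) ^ (k + j + 1) ≤ √(∑ i ∈ Finset.range (j + 1), blockTime k i : ℕ) := by
  refine Real.le_sqrt_of_sq_le ?_
  have hle : blockTime k j ≤ ∑ i ∈ Finset.range (j + 1), blockTime k i :=
    Finset.single_le_sum_of_canonicallyOrdered (Finset.self_mem_range_succ j)
  calc ((2 : ℝ) ^ (k + j + 1)) ^ 2 = (blockTime k j : ℕ) := by
        rw [← pow_mul, mul_comm, pow_mul, blockTime]; norm_num
    _ ≤ (∑ i ∈ Finset.range (j + 1), blockTime k i : ℕ) := by exact_mod_cast hle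

lemma exists_eq_sum_blockTime_add (k : ℕ) {n : ℕ} (hn : blockTime k 0 < n) :
    ∃ j m, m ≤ blockTime k (j + 1) ∧ n = ∑ i ∈ Finset.range (j + 1), blockTime k i + m := by
  have hmono : StrictMono fun j => ∑ i ∈ Finset.range (j + 1), blockTime k i :=
    strictMono_nat_of_lt_succ fun j => by
      rw [Finset.sum_range_succ _ (j + 1)]
      exact Nat.lt_add_of_pos_right (by unfold blockTime; positivity)
  obtain ⟨j, hlt, hle⟩ := hmono.exists_between_of_tendsto_atTop hmono.tendsto_atTop
    (by simpa using hn)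
  obtain ⟨m, rfl⟩ := Nat.exists_eq_add_of_lt hlt
  refine ⟨j, m + 1, ?_, by ring⟩
  rw [Finset.sum_range_succ _ (j + 1)] at hle
  omega

/-- The cutoff of the walk over the block number `j`: a Lipschitz function of its record which is
positive only if the record stays below the start of the next block. -/
def blockCutoff (K k : ℕ) (ξ : Site → ℤˣ) (j : ℕ) : ℝ :=
  bump (blockStart K k j).1.1 (blockHeight K k j) (walker ξ (blockStart K k j) (blockTime k j))

lemma blockCutoff_nonneg (K k : ℕ) (ξ : Site → ℤˣ) (j : ℕ) : 0 ≤ blockCutoff K k ξ j :=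
  bump_nonneg _ _ _

variable {K : ℕ} (hK : 0 < K) (k : ℕ) {ξ : Site → ℤˣ} (h : ∀ j, 0 < blockCutoff K k ξ j)

include hK in
lemma record_le_of_blockCutoff_pos {j : ℕ} (hj : 0 < blockCutoff K k ξ j) :
    record ξ (blockStart K k j) (blockTime k j) ≤ (blockStart K k (j + 1)).1.1 := by
  rw [blockStart_succ_fst]
  exact_mod_cast (lt_of_bump_pos (blockHeight_pos hK k j) hj).le

include hK h

lemma follow_le_sqrt {n : ℕ} (hn : blockTime k 0 < n) :
    ((follow ξ origin n).1.1 : ℝ) ≤ 4 * K * √n := by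
  obtain ⟨j, m, hm, rfl⟩ := exists_eq_sum_blockTime_add k hn
  have hfollow : (follow ξ origin (∑ i ∈ Finset.range (j + 1), blockTime k i + m)).1.1 ≤
      blockHeight K k (j + 2) :=
    calc _ ≤ (blockStart K k (j + 2)).1.1 :=
          follow_sum_add_le (z := blockStart K k) (blockStart_succ_level K k)
            (fun i => record_le_of_blockCutoff_pos hK k (h i)) (j + 1) hm
      _ ≤ blockHeight K k (j + 2) := Int.ofNat_le.2 (sum_blockHeight_le K k (j + 2))
  calc ((follow ξ origin _).1.1 : ℝ) ≤ blockHeight K k (j + 2) := by exact_mod_cast hfollow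
    _ = 4 * K * 2 ^ (k + j + 1) := by rw [blockHeight]; push_cast; ring
    _ ≤ 4 * K * √(∑ i ∈ Finset.range (j + 1), blockTime k i : ℕ) := by
        gcongr; exact two_pow_le_sqrt_sum_blockTime k j
    _ ≤ 4 * K * √(∑ i ∈ Finset.range (j + 1), blockTime k i + m : ℕ) := by gcongr; omega

lemma subdiffusive_of_blockCutoff_pos : Subdiffusive fun n => (follow ξ origin n).1.1 := by
  refine ⟨4 * K, by positivity, Or.inr (limsup_le_of_le (by isBoundedDefault) ?_)⟩
  filter_upwards [eventually_gt_atTop (blockTime k 0)] with n hn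
  have hsqrt : 0 < √(n : ℝ) := Real.sqrt_pos.2 (by exact_mod_cast Nat.zero_lt_of_lt hn)
  rw [EReal.coe_le_coe_iff, div_le_iff₀ hsqrt]
  exact follow_le_sqrt hK k h hn

end Blocks

section LIL

lemma eventually_div_le_half {f : ℕ → ℝ} {C : ℝ} (h : ∀ᶠ n in atTop, f n / √(n : ℝ) ≤ C) :
    ∀ᶠ n : ℕ in atTop, f n / √(2 * (n : ℝ) * Real.log (Real.log n)) ≤ 1 / 2 := by
  have hlim : Tendsto (fun n : ℕ => √(2 * Real.log (Real.log (n : ℝ)))) atTop atTop :=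
    Real.tendsto_sqrt_atTop.comp ((Real.tendsto_log_atTop.comp (Real.tendsto_log_atTop.comp
      tendsto_natCast_atTop_atTop)).const_mul_atTop two_pos)
  filter_upwards [h, hlim.eventually_ge_atTop (2 * C), hlim.eventually_gt_atTop 0]
    with n hn hge hpos
  rw [mul_right_comm, mul_comm _ (n : ℝ), Real.sqrt_mul (Nat.cast_nonneg n), ← div_div,
    div_le_iff₀ hpos]
  linarith

lemma limsup_lilRatio_le_half {π : ℕ → ℤ} {K : ℝ}
    (h : limsup (fun n : ℕ => (((π n : ℝ) / √(n : ℝ) : ℝ) : EReal)) atTop ≤ (K : ℝ)) :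
    limsup (lilRatio π) atTop ≤ ((1 / 2 : ℝ) : EReal) := by
  have hbound : ∀ᶠ n : ℕ in atTop, (π n : ℝ) / √(n : ℝ) ≤ K + 1 := by
    have hlt := h.trans_lt (EReal.coe_lt_coe_iff.2 (lt_add_one K))
    filter_upwards [eventually_lt_of_limsup_lt hlt (by isBoundedDefault)] with n hn
    exact (EReal.coe_lt_coe_iff.1 hn).le
  refine limsup_le_of_le (by isBoundedDefault) ?_
  filter_upwards [eventually_div_le_half hbound] with n hn
  exact EReal.coe_le_coe_iff.2 hn

lemma lilRatio_neg (π : ℕ → ℤ) : lilRatio (-π) = -lilRatio π := by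
  ext n
  simp only [lilRatio, Pi.neg_apply, Int.cast_neg, neg_div, EReal.coe_neg]

lemma Subdiffusive.not_obeysLIL {π : ℕ → ℤ} (h : Subdiffusive π) : ¬ObeysLIL π := by
  have hhalf : ¬(1 : EReal) ≤ ((1 / 2 : ℝ) : EReal) := by
    rw [← EReal.coe_one, EReal.coe_le_coe_iff]; norm_num
  rintro ⟨hsup, hinf⟩
  obtain ⟨K, -, hK | hK⟩ := h
  · have hneg : limsup (fun n : ℕ => ((((-π) n : ℤ) / √(n : ℝ) : ℝ) : EReal)) atTop ≤ (K : ℝ) := by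
      have hfun : (fun n : ℕ => ((((-π) n : ℤ) / √(n : ℝ) : ℝ) : EReal)) =
          -fun n : ℕ => (((π n : ℝ) / √(n : ℝ) : ℝ) : EReal) := by
        ext n
        simp only [Pi.neg_apply, Int.cast_neg, neg_div, EReal.coe_neg]
      rw [hfun, EReal.limsup_neg]
      exact EReal.neg_le_of_neg_le (by rwa [← EReal.coe_neg])
    have hle := limsup_lilRatio_le_half hneg
    rw [lilRatio_neg, EReal.limsup_neg, hinf, neg_neg] at hle
    exact hhalf hle
  · exact hhalf (hsup ▸ limsup_lilRatio_le_half hK)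

end LIL

section System

/-- The arrow configuration that a field of clocks shows at dynamical time `τ`; it is `arrow` for
clocks that are coordinates rather than random variables. -/
def arrows (τ : ℝ) (ω : Site → ℕ → ℝ × ℤˣ) (z : Site) : ℤˣ := clockSign τ (ω z)

/-- The joint law of independent clocks at all sites. -/
abbrev systemLaw : Measure (Site → ℕ → ℝ × ℤˣ) := Measure.infinitePi fun _ => clockLaw

lemma ae_forall_regular : ∀ᵐ ω ∂systemLaw, ∀ z, Regular (ω z) :=
  ae_all_iff.2 fun z =>
    (measurePreserving_eval_infinitePi (fun _ : Site => clockLaw) z).quasiMeasurePreserving.ae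
      ae_regular

lemma isPairField_arrows (s t : ℝ) : IsPairField systemLaw (flipProb s t)
    fun z ω => (arrows s ω z, arrows t ω z) := by
  have hmeas : Measurable fun x => (clockSign s x, clockSign t x) :=
    (measurable_clockSign s).prodMk (measurable_clockSign t)
  refine ⟨fun z => hmeas.comp (measurable_pi_apply z), ?_, fun z a b => ?_⟩
  · exact iIndepFun_infinitePi (P := fun _ : Site => clockLaw)
      (X := fun _ x => (clockSign s x, clockSign t x)) fun _ => hmeas
  · rw [← clockLaw_pair]
    exact (measurePreserving_eval_infinitePi (fun _ : Site => clockLaw) z).measure_preimage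
      (hmeas (measurableSet_singleton (a, b))).nullMeasurableSet

section LocallyConstant

variable {ω : Site → ℕ → ℝ × ℤˣ} (hω : ∀ z, Regular (ω z)) {τ : ℝ}
  (hτ : ∀ z n, clockTime (ω z) n ≠ τ) (z : Site) (n : ℕ)

include hω hτ

lemma eventually_follow_eq :
    ∀ᶠ τ' in nhds τ, follow (arrows τ' ω) z n = follow (arrows τ ω) z n := by
  induction n with
  | zero => exact Eventually.of_forall fun _ => rfl
  | succ n ih =>
    filter_upwards [ih, (hω (follow (arrows τ ω) z n)).eventually_clockSign_eq
      (hτ (follow (arrows τ ω) z n))] with τ' hfollow hsign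
    rw [follow, follow, hfollow, arrows, hsign, arrows]

lemma eventually_record_eq :
    ∀ᶠ τ' in nhds τ, record (arrows τ' ω) z n = record (arrows τ ω) z n := by
  induction n with
  | zero => exact Eventually.of_forall fun _ => rfl
  | succ n ih =>
    filter_upwards [ih, eventually_follow_eq hω hτ z (n + 1)] with τ' hrecord hfollow
    rw [record, record, hrecord, hfollow]

lemma eventually_walker_eq :
    ∀ᶠ τ' in nhds τ, walker (arrows τ' ω) z n = walker (arrows τ ω) z n := by
  filter_upwards [eventually_follow_eq hω hτ z n, eventually_record_eq hω hτ z n]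
    with τ' hfollow hrecord
  rw [walker, walker, hfollow, hrecord]

end LocallyConstant

end System

section BlockMoments

/-- The expectation of the cutoff over the block number `j`. -/
def blockMean (K k j : ℕ) : ℝ :=
  (soloChain.avg ^ blockTime k j) (bump (blockStart K k j).1.1 (blockHeight K k j))
    ((blockStart K k j).1.1, (blockStart K k j).1.1)

/-- The expected product of the cutoffs over the block number `j` at two dynamical times between
which every arrow flips with probability `q`. -/
def blockPairMean (q : unitInterval) (K k j : ℕ) : ℝ :=
  ((pairChain q).avg ^ blockTime k j) (fun σ =>
      bump (blockStart K k j).1.1 (blockHeight K k j) σ.1 *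
        bump (blockStart K k j).1.1 (blockHeight K k j) σ.2)
    (((blockStart K k j).1.1, (blockStart K k j).1.1),
      ((blockStart K k j).1.1, (blockStart K k j).1.1))

/-- The correlation of the cutoffs over the block number `j` at two dynamical times, after they
have been normalized to have expectation one. -/
def blockCorrelation (q : unitInterval) (K k j : ℕ) : ℝ :=
  blockPairMean q K k j / blockMean K k j ^ 2

variable {q : unitInterval} {K k j : ℕ}

lemma sqrt_blockTime : √(blockTime k j : ℝ) = 2 ^ (k + j + 1) := by
  rw [Real.sqrt_eq_iff_mul_self_eq (by positivity) (by positivity), ← mul_pow, blockTime]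
  norm_num

lemma le_blockMean (hK : 0 < K) : 1 - 2 / (K : ℝ) ≤ blockMean K k j := by
  refine le_of_eq_of_le ?_
    (le_soloChain_avg_pow_bump (blockHeight_pos hK k j) (blockStart K k j).1.1 (blockTime k j))
  have hK' : (K : ℝ) ≠ 0 := by positivity
  rw [sqrt_blockTime, blockHeight]
  push_cast
  field_simp

lemma blockPairMean_nonneg : 0 ≤ blockPairMean q K k j :=
  StepChain.avg_pow_nonneg _ (fun _ => mul_nonneg (bump_nonneg _ _ _) (bump_nonneg _ _ _)) _ _

lemma avg_pow_bump_comp_fst :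
    ((pairChain q).avg ^ blockTime k j)
        (bump (blockStart K k j).1.1 (blockHeight K k j) ∘ Prod.fst)
        (((blockStart K k j).1.1, (blockStart K k j).1.1),
          ((blockStart K k j).1.1, (blockStart K k j).1.1)) = blockMean K k j :=
  congrFun (StepChain.avg_pow_comp (pairChain_avg_comp_fst q) _ _) _

lemma blockPairMean_le_blockMean : blockPairMean q K k j ≤ blockMean K k j := by
  rw [← avg_pow_bump_comp_fst (q := q)]
  exact (pairChain q).invariant_univ.avg_pow_mono
    (fun σ _ => mul_le_of_le_one_right (bump_nonneg _ _ σ.1) (bump_le_one _ _ _)) _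
    (Set.mem_univ _)

lemma blockPairMean_le (hq : 0 < (q : ℝ)) (hK : 4 ≤ K) :
    blockPairMean q K k j ≤ blockMean K k j ^ 2 + 1 / √(2 ^ j * (q * 2 ^ (k + 1))) := by
  have hK' : (4 : ℝ) ≤ K := by exact_mod_cast hK
  set r : ℝ := 2 ^ (k + j + 1) with hr
  have hheight : (blockHeight K k j : ℝ) = K * r := by rw [blockHeight, hr]; push_cast; rfl
  have hscale : (2 : ℝ) ^ j * (q * 2 ^ (k + 1)) = q * r := by rw [hr]; ring
  have hgap : √(8 * r / q) ≤ K * r / √(q * r) := by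
    rw [le_div_iff₀ (by positivity), ← Real.sqrt_mul (by positivity)]
    refine Real.sqrt_le_iff.2 ⟨by positivity, ?_⟩
    calc 8 * r / q * (q * r) = 8 * r ^ 2 := by field_simp
      _ ≤ (K : ℝ) ^ 2 * r ^ 2 := by gcongr; nlinarith
      _ = (K * r) ^ 2 := by ring
  refine (pairChain_avg_pow_bump_mul_bump_le hq (blockHeight_pos (by omega) k j)
    (blockStart K k j).1.1 (blockTime k j)).trans (add_le_add le_rfl ?_)
  rw [sqrt_blockTime, ← hr, hheight, hscale, div_le_iff₀ (by positivity), one_div_mul_eq_div]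
  exact hgap

section FourLe

variable (hK : 4 ≤ K)

include hK

lemma half_le_blockMean : 1 / 2 ≤ blockMean K k j := by
  have hK' : (4 : ℝ) ≤ K := by exact_mod_cast hK
  have htwo_div : 2 / (K : ℝ) ≤ 2 / 4 := by gcongr
  linarith [le_blockMean (k := k) (j := j) (by omega : 0 < K)]

lemma blockMean_pos : 0 < blockMean K k j := one_half_pos.trans_le (half_le_blockMean hK)

lemma blockCorrelation_le_inv : blockCorrelation q K k j ≤ (1 - 2 / (K : ℝ))⁻¹ := by
  have hK' : (4 : ℝ) ≤ K := by exact_mod_cast hK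
  have hpos : 0 < 1 - 2 / (K : ℝ) := by rw [sub_pos, div_lt_one] <;> linarith
  have hmean := blockMean_pos (k := k) (j := j) hK
  calc blockCorrelation q K k j ≤ blockMean K k j / blockMean K k j ^ 2 := by
        unfold blockCorrelation; gcongr; exact blockPairMean_le_blockMean
    _ = (blockMean K k j)⁻¹ := by field_simp
    _ ≤ (1 - 2 / (K : ℝ))⁻¹ := inv_anti₀ hpos (le_blockMean (by omega))

lemma blockCorrelation_le (hq : 0 < (q : ℝ)) :
    blockCorrelation q K k j ≤ 1 + 4 / √(2 ^ j * (q * 2 ^ (k + 1))) := by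
  have hmean : 1 / 2 ≤ blockMean K k j := half_le_blockMean hK
  rw [blockCorrelation, div_le_iff₀ (by positivity)]
  calc blockPairMean q K k j ≤ blockMean K k j ^ 2 + 1 / √(2 ^ j * (q * 2 ^ (k + 1))) :=
        blockPairMean_le hq hK
    _ = blockMean K k j ^ 2 + 4 / √(2 ^ j * (q * 2 ^ (k + 1))) * (1 / 2) ^ 2 := by ring
    _ ≤ blockMean K k j ^ 2 + 4 / √(2 ^ j * (q * 2 ^ (k + 1))) * blockMean K k j ^ 2 := by gcongr
    _ = (1 + 4 / √(2 ^ j * (q * 2 ^ (k + 1)))) * blockMean K k j ^ 2 := by ring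

end FourLe

lemma blockCorrelation_nonneg : 0 ≤ blockCorrelation q K k j :=
  div_nonneg blockPairMean_nonneg (sq_nonneg _)

/-- For the finitely many blocks with `2 ^ j * (q * 2 ^ (k + 1)) ≤ 1`, in which the two walks have
no time to decorrelate, only the bound by `(1 - 2 / K)⁻¹` is available: a large `K` makes their
contribution a small power. -/
lemma exists_prod_blockCorrelation_le {b : ℝ} (hb : 0 < b) (hb' : b ≤ 1 / 2) :
    ∃ K : ℕ, 4 ≤ K ∧ ∃ A : ℝ, 0 < A ∧ ∀ (k J : ℕ) (q : unitInterval), 0 < (q : ℝ) →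
      ∏ j ∈ Finset.range J, blockCorrelation q K k j ≤ 1 + A * (q * 2 ^ (k + 1)) ^ (-b) := by
  obtain ⟨A, hA, hprod⟩ := exists_prod_le_one_add_rpow hb hb' (C := 4) (by norm_num)
  have hlim : Tendsto (fun K : ℕ => (1 - 2 / (K : ℝ))⁻¹) atTop (nhds 1) := by
    have hlim_sub : Tendsto (fun K : ℕ => (1 - 2 / (K : ℝ))) atTop (nhds (1 - 0)) :=
      tendsto_const_nhds.sub (tendsto_const_div_atTop_nhds_zero_nat 2)
    simpa using hlim_sub.inv₀ (by norm_num)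
  have hone : (1 : ℝ) < 2 ^ (b / 2) := Real.one_lt_rpow one_lt_two (by linarith)
  obtain ⟨K, hK, hKb⟩ := ((eventually_ge_atTop 4).and (hlim.eventually_le_const hone)).exists
  exact ⟨K, hK, A, hA, fun k J q hq => hprod J _ _ (by positivity)
    (fun _ => blockCorrelation_nonneg) (fun _ => (blockCorrelation_le_inv hK).trans hKb)
    (fun _ => blockCorrelation_le hK hq)⟩

end BlockMoments

section Density

/-- The product of the cutoffs over the first `J` blocks, each normalized to have expectation one.
As a function of `τ` it is the density of a random measure that is carried by the dynamical times
at which all these cutoffs are positive. -/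
def density (K k J : ℕ) (τ : ℝ) (ω : Site → ℕ → ℝ × ℤˣ) : ENNReal :=
  ∏ j ∈ Finset.range J, ENNReal.ofReal ((blockMean K k j)⁻¹ * blockCutoff K k (arrows τ ω) j)

variable {K k J : ℕ}

lemma measurable_density :
    Measurable fun p : ℝ × (Site → ℕ → ℝ × ℤˣ) => density K k J p.1 p.2 := by
  refine Finset.measurable_fun_prod _ fun j _ => ?_
  have hwalker : Measurable fun p : ℝ × (Site → ℕ → ℝ × ℤˣ) =>
      walker (arrows p.1 p.2) (blockStart K k j) (blockTime k j) :=
    measurable_walker fun u _ => measurable_uncurry_clockSign.comp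
      (measurable_fst.prodMk ((measurable_pi_apply u).comp measurable_snd))
  exact (measurable_of_countable fun w => ENNReal.ofReal ((blockMean K k j)⁻¹ *
    bump (blockStart K k j).1.1 (blockHeight K k j) w)).comp hwalker

lemma blockCutoff_pos_of_density_ne_zero {τ : ℝ} {ω : Site → ℕ → ℝ × ℤˣ}
    (h : density K k J τ ω ≠ 0) {j : ℕ} (hj : j < J) : 0 < blockCutoff K k (arrows τ ω) j := by
  refine (blockCutoff_nonneg _ _ _ _).lt_of_ne' fun hzero => Finset.prod_ne_zero_iff.1 h j
    (Finset.mem_range.2 hj) ?_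
  rw [hzero, mul_zero, ENNReal.ofReal_zero]

lemma lintegral_density (hK : 4 ≤ K) (τ : ℝ) : ∫⁻ ω, density K k J τ ω ∂systemLaw = 1 := by
  have hmean (j : ℕ) : 0 < blockMean K k j := blockMean_pos hK
  calc ∫⁻ ω, density K k J τ ω ∂systemLaw =
      ∏ j ∈ Finset.range J, ENNReal.ofReal (((pairChain (flipProb τ τ)).avg ^ blockTime k j)
        ((blockMean K k j)⁻¹ • bump (blockStart K k j).1.1 (blockHeight K k j) ∘ Prod.fst)
        (((blockStart K k j).1.1, (blockStart K k j).1.1),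
          ((blockStart K k j).1.1, (blockStart K k j).1.1))) :=
        (isPairField_arrows τ τ).lintegral_prod_walkerPair (blockStart_succ_level K k)
          (g := fun j => (blockMean K k j)⁻¹ •
            bump (blockStart K k j).1.1 (blockHeight K k j) ∘ Prod.fst)
          (fun j σ => mul_nonneg (inv_nonneg.2 (hmean j).le) (bump_nonneg _ _ _)) J
    _ = 1 := Finset.prod_eq_one fun j _ => by
        rw [map_smul, Pi.smul_apply, avg_pow_bump_comp_fst, smul_eq_mul,
          inv_mul_cancel₀ (hmean j).ne', ENNReal.ofReal_one]

lemma lintegral_density_mul (hK : 4 ≤ K) (s t : ℝ) :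
    ∫⁻ ω, density K k J s ω * density K k J t ω ∂systemLaw =
      ENNReal.ofReal (∏ j ∈ Finset.range J, blockCorrelation (flipProb s t) K k j) := by
  have hmean (j : ℕ) : 0 < blockMean K k j := blockMean_pos hK
  let g (j : ℕ) (σ : (ℤ × ℤ) × (ℤ × ℤ)) : ℝ :=
    bump (blockStart K k j).1.1 (blockHeight K k j) σ.1 *
      bump (blockStart K k j).1.1 (blockHeight K k j) σ.2
  have hg (j : ℕ) (σ : (ℤ × ℤ) × (ℤ × ℤ)) : 0 ≤ g j σ :=
    mul_nonneg (bump_nonneg _ _ _) (bump_nonneg _ _ _)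
  have hdensity (ω : Site → ℕ → ℝ × ℤˣ) : density K k J s ω * density K k J t ω =
      ∏ j ∈ Finset.range J, ENNReal.ofReal (((blockMean K k j ^ 2)⁻¹ • g j)
        (walkerPair (fun z => (arrows s ω z, arrows t ω z)) (blockStart K k j)
          (blockTime k j))) := by
    rw [density, density, ← Finset.prod_mul_distrib]
    refine Finset.prod_congr rfl fun j _ => ?_
    rw [← ENNReal.ofReal_mul (mul_nonneg (inv_nonneg.2 (hmean j).le) (blockCutoff_nonneg _ _ _ _)),
      mul_mul_mul_comm, ← mul_inv, ← sq]
    rfl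
  simp only [hdensity]
  rw [(isPairField_arrows s t).lintegral_prod_walkerPair (blockStart_succ_level K k)
    (g := fun j => (blockMean K k j ^ 2)⁻¹ • g j)
    (fun j σ => mul_nonneg (inv_nonneg.2 (sq_nonneg _)) (hg j σ)) J,
    ENNReal.ofReal_prod_of_nonneg fun _ _ => blockCorrelation_nonneg]
  refine Finset.prod_congr rfl fun j _ => ?_
  rw [map_smul, Pi.smul_apply, smul_eq_mul, blockCorrelation, div_eq_inv_mul]
  rfl

lemma exists_lintegral_density_mul_le {b : ℝ} (hb : 0 < b) (hb' : b ≤ 1 / 2) :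
    ∃ K : ℕ, 4 ≤ K ∧ ∃ δ : ℕ → ENNReal, (∀ k, δ k ≠ ⊤) ∧ Tendsto δ atTop (nhds 0) ∧
      ∀ k J : ℕ, ∀ s ∈ Set.Icc (0 : ℝ) 1, ∀ t ∈ Set.Icc (0 : ℝ) 1, s ≠ t →
        ∫⁻ ω, density K k J s ω * density K k J t ω ∂systemLaw ≤
          1 + δ k * edist s t ^ (-b) := by
  obtain ⟨K, hK, A, hA, hprod⟩ := exists_prod_blockCorrelation_le hb hb'
  set c : ℝ := Real.exp (-1) / 2
  have hc : 0 < c := by positivity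
  let d (k : ℕ) : ℝ := A * (c * 2 ^ (k + 1)) ^ (-b)
  have hd (k : ℕ) : 0 ≤ d k := by positivity
  have hlim : Tendsto d atTop (nhds 0) := by
    have hscale : Tendsto (fun k : ℕ => c * (2 : ℝ) ^ (k + 1)) atTop atTop :=
      ((tendsto_pow_atTop_atTop_of_one_lt one_lt_two).comp
        (tendsto_add_atTop_nat 1)).const_mul_atTop hc
    simpa only [mul_zero, Function.comp_def] using
      ((tendsto_rpow_neg_atTop hb).comp hscale).const_mul A
  refine ⟨K, hK, fun k => ENNReal.ofReal (d k), fun k => ENNReal.ofReal_ne_top,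
    by simpa only [ENNReal.ofReal_zero] using ENNReal.tendsto_ofReal hlim,
    fun k J s hs t ht hst => ?_⟩
  have habs : 0 < |s - t| := abs_pos.2 (sub_ne_zero.2 hst)
  have hflip : c * |s - t| ≤ flipProb s t := le_flipProb hs ht
  have hflip_pos : 0 < (flipProb s t : ℝ) := (mul_pos hc habs).trans_le hflip
  have hreal : ∏ j ∈ Finset.range J, blockCorrelation (flipProb s t) K k j ≤
      1 + d k * |s - t| ^ (-b) :=
    calc _ ≤ 1 + A * (flipProb s t * 2 ^ (k + 1)) ^ (-b) := hprod k J _ hflip_pos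
      _ ≤ 1 + A * (c * |s - t| * 2 ^ (k + 1)) ^ (-b) := by
          gcongr 1 + A * ?_
          exact Real.rpow_le_rpow_of_nonpos (by positivity) (by gcongr) (by linarith)
      _ = 1 + d k * |s - t| ^ (-b) := by
          rw [mul_right_comm c, Real.mul_rpow (by positivity) habs.le, mul_assoc]
  rw [lintegral_density_mul hK, edist_dist, Real.dist_eq, ENNReal.ofReal_rpow_of_pos habs,
    ← ENNReal.ofReal_mul (hd k), ← ENNReal.ofReal_one,
    ← ENNReal.ofReal_add zero_le_one (mul_nonneg (hd k) (by positivity))]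
  exact ENNReal.ofReal_le_ofReal hreal

end Density

section GoodTimes

/-- The dynamical times in the unit interval at which the cutoffs over the first `J` blocks are
positive. -/
def goodTimes (K k J : ℕ) (ω : Site → ℕ → ℝ × ℤˣ) : Set ℝ :=
  {τ | τ ∈ Set.Icc (0 : ℝ) 1 ∧ ∀ j < J, 0 < blockCutoff K k (arrows τ ω) j}

/-- The dynamical times at which the walk from the origin is subdiffusive. -/
def subdiffusiveTimes (ω : Site → ℕ → ℝ × ℤˣ) : Set ℝ :=
  {τ | 0 ≤ τ ∧ Subdiffusive fun n => (follow (arrows τ ω) origin n).1.1}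

variable (K k : ℕ) (ω : Site → ℕ → ℝ × ℤˣ)

lemma antitone_goodTimes : Antitone fun J => goodTimes K k J ω :=
  fun _ _ hle _ hτ => ⟨hτ.1, fun j hj => hτ.2 j (hj.trans_le hle)⟩

lemma closure_goodTimes_subset (J : ℕ) : closure (goodTimes K k J ω) ⊆ Set.Icc 0 1 :=
  closure_minimal (fun _ hτ => hτ.1) isClosed_Icc

lemma iInter_goodTimes_subset (hK : 0 < K) :
    (⋂ J, goodTimes K k J ω) ⊆ subdiffusiveTimes ω := fun τ hτ => by
  rw [Set.mem_iInter] at hτ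
  exact ⟨(hτ 0).1.1, subdiffusive_of_blockCutoff_pos hK k fun j => (hτ (j + 1)).2 j j.lt_succ_self⟩

variable {ω}

/-- Away from the ring times the arrows met by the walk over finitely many steps are locally
constant in `τ`, so that positivity of the cutoffs passes to limits. -/
lemma iInter_closure_goodTimes_subset (hω : ∀ z, Regular (ω z)) :
    (⋂ J, closure (goodTimes K k J ω)) ⊆ (⋂ J, goodTimes K k J ω) ∪
      Set.range fun p : Site × ℕ => clockTime (ω p.1) p.2 := by
  intro τ hτ
  refine or_iff_not_imp_right.2 fun hring => Set.mem_iInter.2 fun J => ?_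
  have hclosure : τ ∈ closure (goodTimes K k J ω) := Set.mem_iInter.1 hτ J
  refine ⟨closure_goodTimes_subset K k ω J hclosure, fun j hj => ?_⟩
  have hwalker := eventually_walker_eq hω (fun z n h => hring ⟨(z, n), h⟩) (blockStart K k j)
    (blockTime k j)
  obtain ⟨τ', hgood, heq⟩ := ((mem_closure_iff_frequently.1 hclosure).and_eventually hwalker).exists
  simpa only [blockCutoff, heq] using hgood.2 j hj

end GoodTimes

section Dimension

lemma energy_unitInterval_ne_top {β : ℝ} (hβ : β < 1) :
    energy β (volume.restrict (Set.Icc (0 : ℝ) 1)) ≠ ⊤ :=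
  energy_restrict_ne_top volume (by rwa [Module.finrank_self, Nat.cast_one])
    (Metric.isBounded_Icc 0 1) measurableSet_Icc

lemma measure_not_le_dimH_subdiffusiveTimes_le {α : NNReal} (hα : 0 < α) {b : ℝ} (hb : 0 < b)
    (hαb : α + b < 1) {K k : ℕ} (hK : 4 ≤ K) {δ : ENNReal} (hδ : δ ≠ ⊤)
    (hcorr : ∀ J : ℕ, ∀ s ∈ Set.Icc (0 : ℝ) 1, ∀ t ∈ Set.Icc (0 : ℝ) 1, s ≠ t →
      ∫⁻ ω, density K k J s ω * density K k J t ω ∂systemLaw ≤ 1 + δ * edist s t ^ (-b)) :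
    systemLaw {ω | ¬ (α : ENNReal) ≤ dimH (subdiffusiveTimes ω)} ≤
      4 * (δ * energy b (volume.restrict (Set.Icc (0 : ℝ) 1))) := by
  have : (0 : ℝ) < α := hα
  have : IsProbabilityMeasure (volume.restrict (Set.Icc (0 : ℝ) 1)) :=
    isProbabilityMeasure_iff.2 (by simp)
  have hIcc : ∀ᵐ s ∂volume.restrict (Set.Icc (0 : ℝ) 1), s ∈ Set.Icc (0 : ℝ) 1 :=
    ae_restrict_mem measurableSet_Icc
  have hmono (ω : Site → ℕ → ℝ × ℤˣ) :
      dimH (⋂ J, goodTimes K k J ω) ≤ dimH (subdiffusiveTimes ω) :=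
    dimH_mono (iInter_goodTimes_subset K k ω (by omega))
  refine (measure_mono
    (Set.ofPred_subset_ofPred.2 fun ω => mt fun hle => hle.trans (hmono ω))).trans
    (measure_not_le_dimH_iInter_le
      (f := density K k) (A := fun ω J => goodTimes K k J ω)
      (fun J => measurable_density) (fun J τ => lintegral_density hK τ) hδ hb (fun J => ?_) hα
      (energy_unitInterval_ne_top (by linarith)) (energy_unitInterval_ne_top hαb)
      (antitone_goodTimes K k)
      (fun ω J => isCompact_Icc.of_isClosed_subset isClosed_closure
        (closure_goodTimes_subset K k ω J))
      (fun ω => Set.countable_range _)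
      (ae_forall_regular.mono fun ω => iInter_closure_goodTimes_subset K k) fun J ω => ?_)
  · filter_upwards [hIcc] with s hs
    filter_upwards [hIcc, Measure.ae_ne _ s] with t ht hts using hcorr J s hs t ht hts.symm
  · filter_upwards [hIcc] with s hs hdensity
    exact ⟨hs, fun j hj => blockCutoff_pos_of_density_ne_zero hdensity hj⟩

lemma ae_le_dimH_subdiffusiveTimes {α : NNReal} (hα : 0 < α) (hα1 : α < 1) :
    ∀ᵐ ω ∂systemLaw, (α : ENNReal) ≤ dimH (subdiffusiveTimes ω) := by
  have : (0 : ℝ) < α := hα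
  have : (α : ℝ) < 1 := hα1
  set b : ℝ := (1 - α) / 2 with hb
  obtain ⟨K, hK, δ, hδ, hδlim, hcorr⟩ := exists_lintegral_density_mul_le (b := b) (by linarith)
    (by linarith)
  have hbound (k : ℕ) := measure_not_le_dimH_subdiffusiveTimes_le hα (b := b) (by linarith)
    (by linarith) hK (hδ k) (hcorr k)
  have henergy : energy b (volume.restrict (Set.Icc (0 : ℝ) 1)) ≠ ⊤ :=
    energy_unitInterval_ne_top (by linarith)
  have hlim := ENNReal.Tendsto.const_mul (a := 4)
    (ENNReal.Tendsto.mul_const hδlim (Or.inr henergy)) (Or.inr (by norm_num))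
  rw [zero_mul, mul_zero] at hlim
  exact ae_iff.2 (le_antisymm (ge_of_tendsto' hlim hbound) zero_le)

lemma ae_one_le_dimH_subdiffusiveTimes : ∀ᵐ ω ∂systemLaw, 1 ≤ dimH (subdiffusiveTimes ω) := by
  obtain ⟨u, -, hu, hlim⟩ := exists_seq_strictMono_tendsto' (zero_lt_one (α := NNReal))
  filter_upwards [ae_all_iff.2 fun n => ae_le_dimH_subdiffusiveTimes (hu n).1 (hu n).2] with ω hω
  exact_mod_cast le_of_tendsto' (ENNReal.tendsto_coe.2 hlim) hω

lemma IsDriving.hasLaw_system {Ω : Type*} [MeasurableSpace Ω] {P : Measure Ω}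
    [IsProbabilityMeasure P] {T : Site → ℕ → Ω → ℝ} {ε : Site → ℕ → Ω → ℤˣ}
    (h : IsDriving P T ε) :
    HasLaw (fun ω (z : Site) (n : ℕ) => (T z n ω, ε z n ω)) systemLaw P := by
  have hpairs : HasLaw (fun ω (p : Site × ℕ) => (T p.1 p.2 ω, ε p.1 p.2 ω))
      (Measure.infinitePi fun _ : Site × ℕ => tickLaw) P :=
    h.indep.hasLaw_infinitePi (fun p => h.hasLaw p.1 p.2)
      (aemeasurable_pi_iff.2 fun p => (h.hasLaw p.1 p.2).aemeasurable)
  have hcurry : HasLaw (MeasurableEquiv.curry Site ℕ (ℝ × ℤˣ)) systemLaw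
      (Measure.infinitePi fun _ : Site × ℕ => tickLaw) :=
    ⟨(MeasurableEquiv.measurable _).aemeasurable,
      Measure.infinitePi_map_curry fun (_ : Site) (_ : ℕ) => tickLaw⟩
  exact hcurry.comp hpairs

end Dimension

end

end DyDW

theorem mainTheorem1 {Ω : Type*} [MeasurableSpace Ω] (P : MeasureTheory.Measure Ω)
    [MeasureTheory.IsProbabilityMeasure P]
    (T : DyDW.Site → ℕ → Ω → ℝ) (ε : DyDW.Site → ℕ → Ω → ℤˣ)
    (h : DyDW.IsDriving P T ε) :
    (∀ᵐ ω ∂P, dimH {τ : ℝ | 0 ≤ τ ∧ DyDW.Subdiffusive (DyDW.walk T ε τ ω)} = 1) ∧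
    (∀ᵐ ω ∂P, dimH {τ : ℝ | 0 ≤ τ ∧ ¬ DyDW.ObeysLIL (DyDW.walk T ε τ ω)} = 1) := by
  have hle (S : Set ℝ) : dimH S ≤ 1 := (dimH_mono (Set.subset_univ S)).trans Real.dimH_univ.le
  have hae : ∀ᵐ ω ∂P, 1 ≤ dimH {τ : ℝ | 0 ≤ τ ∧ DyDW.Subdiffusive (DyDW.walk T ε τ ω)} :=
    ae_of_ae_map h.hasLaw_system.aemeasurable
      (h.hasLaw_system.map_eq ▸ DyDW.ae_one_le_dimH_subdiffusiveTimes)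
  refine ⟨hae.mono fun ω hω => (hle _).antisymm hω, hae.mono fun ω hω => (hle _).antisymm ?_⟩
  exact hω.trans (dimH_mono fun τ hτ => ⟨hτ.1, hτ.2.not_obeysLIL⟩)
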